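/- Consider a continuous-time linear switched system with modes $\Omega=\{1,\dots,M\}$, $M\ge 1$, \[ \dot x(t)=A_{q(t)}x(t)+B_{q(t)}u(t),\qquad y(t)=C_{q(t)}x(t), \] where $A_j\in\mathbb R^{n\times n}$, $B_j\in\mathbb R^{n\times m}$, $C_j\in\mathbb R^{p\times n}$ $(j\in\Omega)$, the switching signal $q$ is piecewise constant with values in $\Omega$ (finitely many break points on every bounded interval), and the input $u$ is locally integrable. Let $\phi(t,x_0,u,q)$ denote the state at time $t$ of the trajectory with initial state $x_0$ at time $0$. The reachable set $\mathcal R$ is the set of all $x\in\mathbb R^n$ for which there are $t_f\ge 0$, a switching signal $q$ and an input $u$ on $[0,t_f]$ with $\phi(t_f,0,u,q)=x$. A state $x$ is unobservable if for every switching signal $q$ on $[0,\infty)$ there is an input $u$ with $C_{q(t)}\phi(t,x,u,q)=C_{q(t)}\phi(t,0,u,q)$ for all $t\ge 0$; the observable set $\mathcal O$ is the orthogonal complement of the set of unobservable states. Put $A=A_1$ and $D_j=A_j-A_1$, and assume that $A$ is Hurwitz, i.e. all its eigenvalues have negative real part. (1) If the generalized Lyapunov equation \[ AP+PA^{T}+\sum_{j=1}^{M}\bigl(D_jPD_j^{T}+B_jB_j^{T}\bigr)=0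 \] has a unique symmetric positive semidefinite solution $P$, then $\mathcal R=\operatorname{range}(P)$. (2) If the generalized Lyapunov equation \[ A^{T}Q+QA+\sum_{j=1}^{M}\bigl(D_j^{T}QD_j+C_j^{T}C_j\bigr)=0 \] has a unique symmetric positive semidefinite solution $Q$, then $\mathcal O=\operatorname{range}(Q)$. -/

import Mathlib

open MeasureTheory Matrix

/-- The data of a continuous-time linear switched system with state space `ℝⁿ`, input space `ℝᵐ`,
output space `ℝᵖ` and `M` modes:
`x' = A_{q(t)} x + B_{q(t)} u`, `y = C_{q(t)} x`.
Modes are numbered from `0`, so that mode `0 : Fin M` is the first mode. -/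
structure LSS (n m p M : ℕ) where
  A : Fin M → Matrix (Fin n) (Fin n) ℝ
  B : Fin M → Matrix (Fin n) (Fin m) ℝ
  C : Fin M → Matrix (Fin p) (Fin n) ℝ

/-- A real square matrix is Hurwitz if all its complex eigenvalues have negative real part. -/
def IsHurwitz {n : ℕ} (A : Matrix (Fin n) (Fin n) ℝ) : Prop :=
  ∀ μ ∈ spectrum ℂ (A.map (fun a : ℝ => (a : ℂ))), μ.re < 0

/-- `q` is piecewise constant on `[0, T]`: there are finitely many break points such that `q` is
constant on every open subinterval of `[0, T]` that contains no break point. -/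
def IsSwitchingSignalOn {M : ℕ} (T : ℝ) (q : ℝ → Fin M) : Prop :=
  ∃ S : Finset ℝ, ∀ a b : ℝ, 0 ≤ a → b ≤ T → (∀ s ∈ S, s ∉ Set.Ioo a b) →
    ∀ s ∈ Set.Ioo a b, ∀ t ∈ Set.Ioo a b, q s = q t

/-- `u` is an admissible (i.e. integrable) input on `[0, T]`. -/
def IsInputOn {m : ℕ} (T : ℝ) (u : ℝ → Fin m → ℝ) : Prop :=
  IntervalIntegrable u volume 0 T

namespace LSS

variable {n m p M : ℕ}

/-- `x` is the state trajectory on `[0, T]` with initial state `x₀`, input `u` and switching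
signal `q`: it is continuous and satisfies the state equation in integrated form. -/
structure IsTrajectoryOn (sys : LSS n m p M) (T : ℝ) (x₀ : Fin n → ℝ) (u : ℝ → Fin m → ℝ)
    (q : ℝ → Fin M) (x : ℝ → Fin n → ℝ) : Prop where
  continuousOn : ContinuousOn x (Set.Icc 0 T)
  eq_integral : ∀ t ∈ Set.Icc 0 T,
    x t = x₀ + ∫ s in (0 : ℝ)..t, (sys.A (q s) *ᵥ x s + sys.B (q s) *ᵥ u s)

/-- The set of states that can be reached from `0` in some finite time, by some switching signal
and some input. -/
def reachableSet (sys : LSS n m p M) : Set (Fin n → ℝ) :=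
  {x | ∃ tf : ℝ, 0 ≤ tf ∧ ∃ q : ℝ → Fin M, IsSwitchingSignalOn tf q ∧
    ∃ u : ℝ → Fin m → ℝ, IsInputOn tf u ∧
    ∃ φ : ℝ → Fin n → ℝ, sys.IsTrajectoryOn tf 0 u q φ ∧ φ tf = x}

/-- The set of unobservable states: for every switching signal on `[0, ∞)` there is an input for
which the outputs starting from `x` and from `0` coincide at all times. -/
def unobservableSet (sys : LSS n m p M) : Set (Fin n → ℝ) :=
  {x | ∀ q : ℝ → Fin M, (∀ T : ℝ, 0 ≤ T → IsSwitchingSignalOn T q) →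
    ∃ u : ℝ → Fin m → ℝ, (∀ T : ℝ, 0 ≤ T → IsInputOn T u) ∧
    ∃ φ φ₀ : ℝ → Fin n → ℝ,
      (∀ T : ℝ, 0 ≤ T → sys.IsTrajectoryOn T x u q φ) ∧
      (∀ T : ℝ, 0 ≤ T → sys.IsTrajectoryOn T 0 u q φ₀) ∧
      ∀ t : ℝ, 0 ≤ t → sys.C (q t) *ᵥ φ t = sys.C (q t) *ᵥ φ₀ t}

/-- The observable set: the orthogonal complement of the unobservable set in Euclidean `ℝⁿ`. -/
def observableSet (sys : LSS n m p M) : Set (Fin n → ℝ) :=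
  {y | ∀ x ∈ sys.unobservableSet, x ⬝ᵥ y = 0}

/-- `D_j = A_j - A_1`. -/
def D [NeZero M] (sys : LSS n m p M) (j : Fin M) : Matrix (Fin n) (Fin n) ℝ :=
  sys.A j - sys.A 0

/-- The generalized Lyapunov equation for the reachability Gramian. -/
def ReachLyapunovEq [NeZero M] (sys : LSS n m p M) (P : Matrix (Fin n) (Fin n) ℝ) : Prop :=
  sys.A 0 * P + P * (sys.A 0)ᵀ +
    ∑ j : Fin M, (sys.D j * P * (sys.D j)ᵀ + sys.B j * (sys.B j)ᵀ) = 0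

/-- The generalized Lyapunov equation for the observability Gramian. -/
def ObservLyapunovEq [NeZero M] (sys : LSS n m p M) (Q : Matrix (Fin n) (Fin n) ℝ) : Prop :=
  (sys.A 0)ᵀ * Q + Q * sys.A 0 +
    ∑ j : Fin M, ((sys.D j)ᵀ * Q * sys.D j + (sys.C j)ᵀ * sys.C j) = 0

/-- `P` is the unique symmetric positive semidefinite solution of the reachability equation. -/
structure IsReachGramian [NeZero M] (sys : LSS n m p M) (P : Matrix (Fin n) (Fin n) ℝ) :
    Prop where
  posSemidef : P.PosSemidef
  eq : sys.ReachLyapunovEq P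
  unique : ∀ P' : Matrix (Fin n) (Fin n) ℝ, P'.PosSemidef → sys.ReachLyapunovEq P' → P' = P

/-- `Q` is the unique symmetric positive semidefinite solution of the observability equation. -/
structure IsObservGramian [NeZero M] (sys : LSS n m p M) (Q : Matrix (Fin n) (Fin n) ℝ) :
    Prop where
  posSemidef : Q.PosSemidef
  eq : sys.ObservLyapunovEq Q
  unique : ∀ Q' : Matrix (Fin n) (Fin n) ℝ, Q'.PosSemidef → sys.ObservLyapunovEq Q' → Q' = Q

end LSS

/-! Write `L X = A X + X Aᵀ` and `G Y = ∑ⱼ (Dⱼ Y Dⱼᵀ + Bⱼ Bⱼᵀ)`, so that the reachability equation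
is `L P + G P = 0`. Both claims rest on comparing range(P) with subspaces invariant under all modes.

If P ≥ 0 solves the equation and P x = 0, then testing it against x leaves a vanishing sum of
nonnegative terms. Hence ker P is invariant under all transposed modes and is killed by all `Bⱼᵀ`
(`ker_of_generalized_lyapunov`). Dually, range(P) is invariant under all modes and contains every
range(Bⱼ), so by Grönwall trajectories from 0 never leave it.

Conversely, range(P) lies in every subspace V with these invariance properties
(`IsHurwitz.gramian_mulVec_mem`). Among the Y with 0 ≤ Y ≤ P, range in V and `L Y + G Y ≥ 0`, take a
maximal one. The solution Z of `L Z = - G Y` is admissible and Z ≥ Y, so Z = Y solves the equation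
and uniqueness gives Y = P. Here A Hurwitz makes `-L` invertible with positive inverse, proved
without integrals through the Cayley transform.

It remains to find such a V inside the reachable set. The states reached along a fixed list of modes
and durations with piecewise constant inputs form a subspace. One of maximal dimension contains all
the others, hence is invariant.

For observability, linearity removes the input. The unobservable states form a subspace invariant
under all `Aⱼ` and killed by all `Cⱼ`. Its orthogonal complement is a V for the transposed data, and
ker Q consists of unobservable states. -/

open Filter Topology in
/-- In a complex Banach algebra, the powers of an element whose spectrum lies in the open unit disc
tend to zero. -/
theorem tendsto_pow_zero_of_forall_mem_spectrum {𝔸 : Type*} [NormedRing 𝔸] [NormedAlgebra ℂ 𝔸]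
    [CompleteSpace 𝔸] (a : 𝔸) (ha : ∀ z ∈ spectrum ℂ a, ‖z‖ < 1) :
    Tendsto (fun k : ℕ => a ^ k) atTop (𝓝 0) := by
  rcases subsingleton_or_nontrivial 𝔸 with h𝔸 | h𝔸
  · exact tendsto_const_nhds.congr fun k => Subsingleton.elim _ _
  -- The spectrum is compact and nonempty, so a pointwise bound is a strict bound on the spectral
  -- radius; Gelfand's formula then makes `‖a ^ k‖` eventually at most `r ^ k` with r < 1.
  have hlt : spectralRadius ℂ a < (1 : NNReal) :=
    spectrum.spectralRadius_lt_of_forall_lt a fun z hz => by exact_mod_cast ha z hz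
  obtain ⟨r, hr, hr1⟩ := ENNReal.lt_iff_exists_nnreal_btwn.1 hlt
  have hev := (spectrum.pow_nnnorm_pow_one_div_tendsto_nhds_spectralRadius a).eventually_lt_const hr
  have hr1' : (r : ℝ) < 1 := by exact_mod_cast hr1
  rw [tendsto_zero_iff_norm_tendsto_zero]
  refine tendsto_of_tendsto_of_tendsto_of_le_of_le' tendsto_const_nhds
    (tendsto_pow_atTop_nhds_zero_of_lt_one r.2 hr1') (.of_forall fun k => norm_nonneg _) ?_
  filter_upwards [hev, eventually_gt_atTop 0] with k hk hk0
  have hk' : ((‖a ^ k‖₊ : NNReal) : ENNReal) < (r : ENNReal) ^ (k : ℝ) := by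
    have := ENNReal.rpow_lt_rpow hk (show (0 : ℝ) < k by exact_mod_cast hk0)
    rwa [← ENNReal.rpow_mul, one_div, inv_mul_cancel₀ (by positivity), ENNReal.rpow_one] at this
  rw [ENNReal.rpow_natCast] at hk'
  exact_mod_cast hk'.le

/-! ### The Lyapunov operator of a Hurwitz matrix -/

section Lyapunov

variable {n : ℕ}

open scoped Matrix.Norms.Operator in
theorem Matrix.tendsto_pow_zero_of_forall_mem_spectrum (C : Matrix (Fin n) (Fin n) ℝ)
    (hC : ∀ z ∈ spectrum ℂ (C.map (fun a : ℝ => (a : ℂ))), ‖z‖ < 1) :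
    Filter.Tendsto (fun k : ℕ => C ^ k) Filter.atTop (nhds 0) := by
  have h := _root_.tendsto_pow_zero_of_forall_mem_spectrum _ hC
  have hre : Continuous fun X : Matrix (Fin n) (Fin n) ℂ => X.map Complex.re :=
    continuous_id.matrix_map Complex.continuous_re
  have h2 := (hre.tendsto 0).comp h
  have hmap : ∀ k : ℕ, (C.map (fun a : ℝ => (a : ℂ))) ^ k = (C ^ k).map (fun a : ℝ => (a : ℂ)) :=
    fun k => (map_pow (Complex.ofRealHom.mapMatrix (m := Fin n)) C k).symm
  have h0 : (0 : Matrix (Fin n) (Fin n) ℂ).map Complex.re = 0 := by ext; simp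
  rw [h0] at h2
  refine h2.congr fun k => ?_
  ext i j
  simp [hmap]

theorem IsHurwitz.isUnit_one_sub {A : Matrix (Fin n) (Fin n) ℝ} (hA : IsHurwitz A) :
    IsUnit (1 - A) := by
  have h1 : (1 : ℂ) ∉ spectrum ℂ (A.map (fun a : ℝ => (a : ℂ))) := fun h => by
    have := hA 1 h
    norm_num at this
  rw [spectrum.notMem_iff, map_one] at h1
  have h2 : (1 : Matrix (Fin n) (Fin n) ℂ) - A.map (fun a : ℝ => (a : ℂ)) =
      (1 - A).map (fun a : ℝ => (a : ℂ)) := by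
    have := map_sub (Complex.ofRealHom.mapMatrix (m := Fin n)) 1 A
    rw [map_one] at this
    exact this.symm
  rw [h2, Matrix.isUnit_iff_isUnit_det] at h1
  have h3 : ((1 - A).map (fun a : ℝ => (a : ℂ))).det = ((1 - A).det : ℂ) :=
    (RingHom.map_det Complex.ofRealHom (1 - A)).symm
  rw [Matrix.isUnit_iff_isUnit_det, isUnit_iff_ne_zero]
  rw [h3, isUnit_iff_ne_zero] at h1
  exact_mod_cast h1

/-- The Cayley transform of a Hurwitz matrix is Schur stable. -/
theorem IsHurwitz.norm_lt_one_of_mem_spectrum_cayley {A R : Matrix (Fin n) (Fin n) ℝ}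
    (hA : IsHurwitz A) (hR : (1 - A) * R = 1) (z : ℂ)
    (hz : z ∈ spectrum ℂ (((1 + A) * R).map (fun a : ℝ => (a : ℂ)))) : ‖z‖ < 1 := by
  set Ac := A.map (fun a : ℝ => (a : ℂ)) with hAc
  set Rc := R.map (fun a : ℝ => (a : ℂ)) with hRc
  let φ := Complex.ofRealHom.mapMatrix (m := Fin n)
  have hRc1 : (1 - Ac) * Rc = 1 := by
    have := congrArg φ hR
    rwa [map_mul, map_sub, map_one] at this
  have hCc : ((1 + A) * R).map (fun a : ℝ => (a : ℂ)) = (1 + Ac) * Rc := by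
    have : φ ((1 + A) * R) = (1 + φ A) * φ R := by rw [map_mul, map_add, map_one]
    exact this
  have hRu : IsUnit Rc := IsUnit.of_mul_eq_one_right _ hRc1
  have hkey : algebraMap ℂ _ z - (1 + Ac) * Rc = ((z - 1) • 1 - (z + 1) • Ac) * Rc := by
    rw [Algebra.algebraMap_eq_smul_one]
    have h1 : z • (1 : Matrix (Fin n) (Fin n) ℂ) = z • ((1 - Ac) * Rc) := by rw [hRc1]
    rw [h1]
    simp only [sub_mul, add_mul, smul_mul_assoc, one_mul, smul_sub, sub_smul, add_smul, one_smul]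
    abel
  rw [hCc, spectrum.mem_iff, hkey] at hz
  -- At z = -1 the inverse Cayley transform has its pole, but there the matrix in `hkey` is -2 times
  -- the invertible `Rc`.
  by_cases hz1 : z + 1 = 0
  · refine absurd ?_ hz
    rw [hz1, zero_smul, sub_zero]
    refine IsUnit.mul ?_ hRu
    have hz2 : z - 1 = -2 := by linear_combination hz1
    rw [hz2, ← Algebra.algebraMap_eq_smul_one]
    exact (isUnit_iff_ne_zero.2 (by norm_num)).map _
  have hmem : (z - 1) / (z + 1) ∈ spectrum ℂ Ac := by
    rw [spectrum.mem_iff]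
    intro hu
    refine hz (IsUnit.mul ?_ hRu)
    have : (z - 1) • (1 : Matrix (Fin n) (Fin n) ℂ) - (z + 1) • Ac =
        algebraMap ℂ _ (z + 1) * (algebraMap ℂ _ ((z - 1) / (z + 1)) - Ac) := by
      rw [mul_sub, ← map_mul, mul_div_cancel₀ _ hz1, Algebra.algebraMap_eq_smul_one,
        Algebra.algebraMap_eq_smul_one, smul_mul_assoc, one_mul]
    rw [this]
    exact ((isUnit_iff_ne_zero.2 hz1).map _).mul hu
  -- Re((z - 1)/(z + 1)) = (|z|² - 1)/|z + 1|², so the left half-plane corresponds to the unit disc.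
  have hre := hA _ hmem
  have hpos : 0 < Complex.normSq (z + 1) := Complex.normSq_pos.2 hz1
  rw [Complex.div_re, ← add_div, div_lt_iff₀ hpos, zero_mul] at hre
  have hsq : ‖z‖ ^ 2 < 1 := by
    rw [Complex.sq_norm, Complex.normSq_apply]
    simp at hre
    nlinarith
  nlinarith [norm_nonneg z]

/-- A Hurwitz matrix `A` has matrices `R`, `C` with `Cᵏ → 0` that turn the Lyapunov operator of `A`
into the Stein operator of `C`. -/
theorem IsHurwitz.exists_stein {A : Matrix (Fin n) (Fin n) ℝ} (hA : IsHurwitz A) :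
    ∃ R C : Matrix (Fin n) (Fin n) ℝ, Filter.Tendsto (fun k : ℕ => C ^ k) Filter.atTop (nhds 0) ∧
      ∀ X, X - C * X * Cᵀ = R * ((-2 : ℝ) • (A * X + X * Aᵀ)) * Rᵀ := by
  obtain ⟨u, hu⟩ := hA.isUnit_one_sub
  set R : Matrix (Fin n) (Fin n) ℝ := ↑u⁻¹ with hRdef
  have hR : (1 - A) * R = 1 := by rw [← hu]; exact u.mul_inv
  have hR' : R * (1 - A) = 1 := by rw [← hu]; exact u.inv_mul
  refine ⟨R, (1 + A) * R,
    Matrix.tendsto_pow_zero_of_forall_mem_spectrum _ (hA.norm_lt_one_of_mem_spectrum_cayley hR),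
    fun X => ?_⟩
  have hcomm : (1 + A) * R = R * (1 + A) := by
    have h2 : (1 + A) = 2 - (1 - A) := by
      rw [← one_add_one_eq_two]; abel
    rw [h2, sub_mul, mul_sub, hR, hR']
    congr 1
    rw [two_mul, mul_two]
  -- With X written this way, the claim reduces to (1 - A) X (1 - A)ᵀ - (1 + A) X (1 + A)ᵀ = -2 (A X
  -- + X Aᵀ).
  have hX : X = R * ((1 - A) * X * (1 - A)ᵀ) * Rᵀ := by
    calc X = (R * (1 - A)) * X * (R * (1 - A))ᵀ := by rw [hR']; simp
      _ = _ := by rw [transpose_mul]; simp only [mul_assoc]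
  rw [hcomm]
  conv_lhs => enter [1]; rw [hX]
  rw [transpose_mul]
  have : R * (1 + A) * X * ((1 + A)ᵀ * Rᵀ) = R * ((1 + A) * X * (1 + A)ᵀ) * Rᵀ := by
    simp only [mul_assoc]
  rw [this, ← sub_mul, ← mul_sub]
  congr 2
  simp only [transpose_sub, transpose_add, transpose_one, sub_mul, mul_sub, add_mul, mul_add,
    one_mul, mul_one, neg_smul, two_smul]
  abel

theorem mul_pow_eq_of_stein {X C : Matrix (Fin n) (Fin n) ℝ} (h : X = C * X * Cᵀ) (k : ℕ) :
    X = C ^ k * X * (C ^ k)ᵀ := by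
  induction k with
  | zero => simp
  | succ k ih =>
    calc X = C ^ k * (C * X * Cᵀ) * (C ^ k)ᵀ := by rw [← h]; exact ih
      _ = _ := by rw [pow_succ, transpose_mul]; simp only [mul_assoc]

/-- The Stein form gives X = Cᵏ X (Cᵏ)ᵀ for all k, and the right side tends to 0. -/
theorem IsHurwitz.eq_zero_of_lyapunov {A X : Matrix (Fin n) (Fin n) ℝ} (hA : IsHurwitz A)
    (h : A * X + X * Aᵀ = 0) : X = 0 := by
  obtain ⟨R, C, hC, hst⟩ := hA.exists_stein
  have hX : X = C * X * Cᵀ := by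
    have := hst X
    rw [h] at this
    simpa [sub_eq_zero] using this
  have hcont : Continuous fun Y : Matrix (Fin n) (Fin n) ℝ => Y * X * Yᵀ := by fun_prop
  have hlim := (hcont.tendsto 0).comp hC
  have hconst : (fun Y : Matrix (Fin n) (Fin n) ℝ => Y * X * Yᵀ) ∘ (fun k : ℕ => C ^ k) =
      fun _ => X := funext fun k => (mul_pow_eq_of_stein hX k).symm
  rw [hconst] at hlim
  simpa using tendsto_nhds_unique tendsto_const_nhds hlim

theorem Matrix.dotProduct_mul_mul_transpose_mulVec {l : ℕ} (R : Matrix (Fin n) (Fin l) ℝ)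
    (Y : Matrix (Fin l) (Fin l) ℝ) (y : Fin n → ℝ) :
    y ⬝ᵥ (R * Y * Rᵀ) *ᵥ y = (Rᵀ *ᵥ y) ⬝ᵥ Y *ᵥ (Rᵀ *ᵥ y) := by
  rw [mulVec_transpose, ← dotProduct_mulVec, mulVec_mulVec, ← mulVec_transpose, mulVec_mulVec]

/-- The quadratic form of X does not increase along y ↦ Cᵀ y, and these iterates tend to 0, so its
initial value is at least 0. -/
theorem IsHurwitz.dotProduct_mulVec_nonneg_of_lyapunov {A X : Matrix (Fin n) (Fin n) ℝ}
    (hA : IsHurwitz A) (h : (-(A * X + X * Aᵀ)).PosSemidef) (x : Fin n → ℝ) :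
    0 ≤ x ⬝ᵥ X *ᵥ x := by
  obtain ⟨R, C, hC, hst⟩ := hA.exists_stein
  have hstep : ∀ y : Fin n → ℝ, (Cᵀ *ᵥ y) ⬝ᵥ X *ᵥ (Cᵀ *ᵥ y) ≤ y ⬝ᵥ X *ᵥ y := by
    intro y
    have h1 : y ⬝ᵥ (X - C * X * Cᵀ) *ᵥ y =
        2 * ((Rᵀ *ᵥ y) ⬝ᵥ (-(A * X + X * Aᵀ)) *ᵥ (Rᵀ *ᵥ y)) := by
      rw [hst X, dotProduct_mul_mul_transpose_mulVec, neg_mulVec, smul_mulVec, dotProduct_smul,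
        dotProduct_neg, smul_eq_mul]
      ring
    have h2 := h.dotProduct_mulVec_nonneg (Rᵀ *ᵥ y)
    rw [star_trivial] at h2
    rw [sub_mulVec, dotProduct_sub, dotProduct_mul_mul_transpose_mulVec] at h1
    linarith
  have hpow : ∀ k : ℕ, ((C ^ k)ᵀ *ᵥ x) ⬝ᵥ X *ᵥ ((C ^ k)ᵀ *ᵥ x) ≤ x ⬝ᵥ X *ᵥ x := by
    intro k
    induction k with
    | zero => simp
    | succ k ih =>
      refine le_trans ?_ ih
      have := hstep ((C ^ k)ᵀ *ᵥ x)
      rwa [mulVec_mulVec, ← transpose_mul, ← pow_succ] at this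
  have hcont : Continuous fun Y : Matrix (Fin n) (Fin n) ℝ => (Yᵀ *ᵥ x) ⬝ᵥ X *ᵥ (Yᵀ *ᵥ x) := by
    fun_prop
  have hlim := (hcont.tendsto 0).comp hC
  rw [transpose_zero, zero_mulVec, zero_dotProduct] at hlim
  exact le_of_tendsto' hlim hpow

end Lyapunov

/-! ### Ranges and kernels of solutions of the generalized Lyapunov equation -/

section Gramian

variable {n m : ℕ} {ι : Type*} [Fintype ι]

/-- Symmetric matrices whose range is contained in a given subspace. -/
def symmetricWithRangeIn (V : Submodule ℝ (Fin n → ℝ)) :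
    Submodule ℝ (Matrix (Fin n) (Fin n) ℝ) where
  carrier := {X | Xᵀ = X ∧ ∀ x, X *ᵥ x ∈ V}
  add_mem' := fun hX hY => ⟨by rw [transpose_add, hX.1, hY.1], fun x => by
    rw [add_mulVec]; exact V.add_mem (hX.2 x) (hY.2 x)⟩
  zero_mem' := ⟨transpose_zero, fun x => by rw [zero_mulVec]; exact V.zero_mem⟩
  smul_mem' := fun c X hX => ⟨by rw [transpose_smul, hX.1], fun x => by
    rw [smul_mulVec]; exact V.smul_mem c (hX.2 x)⟩

/-- The Lyapunov operator `X ↦ A X + X Aᵀ`. -/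
def lyapunovOperator (A : Matrix (Fin n) (Fin n) ℝ) :
    Matrix (Fin n) (Fin n) ℝ →ₗ[ℝ] Matrix (Fin n) (Fin n) ℝ :=
  LinearMap.mulLeft ℝ A + LinearMap.mulRight ℝ Aᵀ

theorem lyapunovOperator_apply (A X : Matrix (Fin n) (Fin n) ℝ) :
    lyapunovOperator A X = A * X + X * Aᵀ := rfl

/-- The operator preserves the finite-dimensional space of symmetric matrices with range in V and is
injective, hence surjective there. Thus the solution keeps its range in V. -/
theorem IsHurwitz.exists_lyapunov_eq {A : Matrix (Fin n) (Fin n) ℝ} (hA : IsHurwitz A)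
    {V : Submodule ℝ (Fin n → ℝ)} (hAV : ∀ x ∈ V, A *ᵥ x ∈ V) {G : Matrix (Fin n) (Fin n) ℝ}
    (hG : G ∈ symmetricWithRangeIn V) :
    ∃ Z ∈ symmetricWithRangeIn V, lyapunovOperator A Z = G := by
  have hmaps : ∀ X ∈ symmetricWithRangeIn V, lyapunovOperator A X ∈ symmetricWithRangeIn V := by
    refine fun X hX => ⟨?_, fun x => ?_⟩
    · rw [lyapunovOperator_apply, transpose_add, transpose_mul, transpose_mul, hX.1,
        transpose_transpose, add_comm]
    · rw [lyapunovOperator_apply, add_mulVec, ← mulVec_mulVec, ← mulVec_mulVec]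
      exact V.add_mem (hAV _ (hX.2 x)) (hX.2 _)
  have hinj : Function.Injective ((lyapunovOperator A).restrict hmaps) := by
    rw [injective_iff_map_eq_zero]
    intro X hX
    exact Subtype.ext (hA.eq_zero_of_lyapunov (congrArg Subtype.val hX))
  obtain ⟨Z, hZ⟩ := LinearMap.injective_iff_surjective.1 hinj ⟨G, hG⟩
  exact ⟨Z, Z.2, congrArg Subtype.val hZ⟩

/-- The map `Y ↦ ∑ⱼ (Dⱼ Y Dⱼᵀ + Bⱼ Bⱼᵀ)` of the generalized Lyapunov equation. -/
def lyapunovForcing (D : ι → Matrix (Fin n) (Fin n) ℝ) (B : ι → Matrix (Fin n) (Fin m) ℝ)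
    (Y : Matrix (Fin n) (Fin n) ℝ) : Matrix (Fin n) (Fin n) ℝ :=
  ∑ j, (D j * Y * (D j)ᵀ + B j * (B j)ᵀ)

theorem lyapunovForcing_mem {D : ι → Matrix (Fin n) (Fin n) ℝ} {B : ι → Matrix (Fin n) (Fin m) ℝ}
    {V : Submodule ℝ (Fin n → ℝ)} (hD : ∀ j, ∀ x ∈ V, D j *ᵥ x ∈ V) (hB : ∀ j v, B j *ᵥ v ∈ V)
    {Y : Matrix (Fin n) (Fin n) ℝ} (hY : Y ∈ symmetricWithRangeIn V) :
    lyapunovForcing D B Y ∈ symmetricWithRangeIn V := by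
  refine Submodule.sum_mem _ fun j _ => Submodule.add_mem _ ⟨?_, fun x => ?_⟩ ⟨?_, fun x => ?_⟩
  · simp only [transpose_mul, transpose_transpose, hY.1, mul_assoc]
  · rw [mul_assoc, ← mulVec_mulVec, ← mulVec_mulVec]
    exact hD j _ (hY.2 _)
  · simp only [transpose_mul, transpose_transpose]
  · rw [← mulVec_mulVec]
    exact hB j _

theorem Matrix.PosSemidef.lyapunovForcing_sub {D : ι → Matrix (Fin n) (Fin n) ℝ}
    (B : ι → Matrix (Fin n) (Fin m) ℝ) {X Y : Matrix (Fin n) (Fin n) ℝ} (h : (Y - X).PosSemidef) :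
    (lyapunovForcing D B Y - lyapunovForcing D B X).PosSemidef := by
  have : lyapunovForcing D B Y - lyapunovForcing D B X = ∑ j, D j * (Y - X) * (D j)ᵀ := by
    simp only [lyapunovForcing, ← Finset.sum_sub_distrib, mul_sub, sub_mul, add_sub_add_right_eq_sub]
  rw [this]
  exact posSemidef_sum _ fun j _ => h.mul_mul_conjTranspose_same (D j)

theorem Matrix.isClosed_setOf_posSemidef :
    IsClosed {X : Matrix (Fin n) (Fin n) ℝ | X.PosSemidef} := by
  simp only [posSemidef_iff_dotProduct_mulVec, IsHermitian, Set.ofPred_and, Set.ofPred_forall]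
  refine IsClosed.inter (isClosed_eq (by fun_prop) continuous_id) (isClosed_iInter fun x => ?_)
  exact isClosed_le continuous_const (by fun_prop)

/-- Testing on eᵢ ± eⱼ bounds 2|X i j| by X i i + X j j. This makes Loewner intervals bounded, hence
the closed sets in them compact. -/
theorem Matrix.PosSemidef.abs_apply_le {X : Matrix (Fin n) (Fin n) ℝ} (h : X.PosSemidef)
    (i j : Fin n) : |X i j| ≤ X.trace := by
  have hd : ∀ k, 0 ≤ X k k := fun k => h.diag_nonneg
  have hle : ∀ k, X k k ≤ X.trace := fun k =>
    Finset.single_le_sum (f := fun k => X k k) (fun k _ => hd k) (Finset.mem_univ k)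
  have hsym : X j i = X i j := h.1.apply i j
  have hp := h.dotProduct_mulVec_nonneg (Pi.single i 1 + Pi.single j 1)
  have hm := h.dotProduct_mulVec_nonneg (Pi.single i 1 - Pi.single j 1)
  simp [mulVec_add, mulVec_sub, add_dotProduct, sub_dotProduct, hsym] at hp hm
  rw [abs_le]
  constructor <;> linarith [hle i, hle j]

/-- A nonempty closed set of positive semidefinite matrices below a fixed matrix has a maximal element
for the Loewner order. -/
theorem exists_maximal_posSemidef {P : Matrix (Fin n) (Fin n) ℝ}
    {K : Set (Matrix (Fin n) (Fin n) ℝ)} (hne : K.Nonempty) (hcl : IsClosed K)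
    (hK : ∀ Y ∈ K, Y.PosSemidef ∧ (P - Y).PosSemidef) :
    ∃ Y ∈ K, ∀ Z ∈ K, (Z - Y).PosSemidef → Z = Y := by
  have hcomp : IsCompact K := by
    have hbox : IsCompact (Set.univ.pi fun _ : Fin n => Set.univ.pi fun _ : Fin n =>
        Set.Icc (-P.trace) P.trace) :=
      isCompact_univ_pi fun _ => isCompact_univ_pi fun _ => isCompact_Icc
    refine hbox.of_isClosed_subset hcl fun (Y : Matrix (Fin n) (Fin n) ℝ) hY i _ j _ => ?_
    have h1 := (hK Y hY).1.abs_apply_le i j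
    have h2 := (hK Y hY).2.trace_nonneg
    rw [trace_sub] at h2
    exact abs_le.1 (h1.trans (by linarith))
  -- A trace maximizer is Loewner-maximal, because a positive semidefinite matrix of trace at most 0
  -- vanishes.
  obtain ⟨Y, hY, hmax⟩ := hcomp.exists_isMaxOn hne
    (f := fun X => X.trace)
    (by fun_prop : Continuous fun X : Matrix (Fin n) (Fin n) ℝ => X.trace).continuousOn
  refine ⟨Y, hY, fun Z hZ hZY => ?_⟩
  have h1 : (Z - Y).trace ≤ 0 := by rw [trace_sub]; exact sub_nonpos.2 (hmax hZ)
  exact sub_eq_zero.1 (hZY.trace_eq_zero_iff.1 (le_antisymm h1 hZY.trace_nonneg))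

/-- A maximal subsolution below P with range in V is a fixed point of Y ↦ -L⁻¹(G Y), hence equals P
by uniqueness. -/
theorem IsHurwitz.gramian_mulVec_mem {A : Matrix (Fin n) (Fin n) ℝ} (hA : IsHurwitz A)
    {D : ι → Matrix (Fin n) (Fin n) ℝ} {B : ι → Matrix (Fin n) (Fin m) ℝ}
    {P : Matrix (Fin n) (Fin n) ℝ} (hP : P.PosSemidef)
    (heq : A * P + P * Aᵀ + lyapunovForcing D B P = 0)
    (huniq : ∀ P' : Matrix (Fin n) (Fin n) ℝ, P'.PosSemidef →
      A * P' + P' * Aᵀ + lyapunovForcing D B P' = 0 → P' = P)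
    {V : Submodule ℝ (Fin n → ℝ)} (hAV : ∀ x ∈ V, A *ᵥ x ∈ V)
    (hDV : ∀ j, ∀ x ∈ V, D j *ᵥ x ∈ V) (hBV : ∀ j v, B j *ᵥ v ∈ V) (x : Fin n → ℝ) :
    P *ᵥ x ∈ V := by
  simp only [← lyapunovOperator_apply] at heq huniq
  have hLc : Continuous (lyapunovOperator A) := LinearMap.continuous_of_finiteDimensional _
  have hGc : Continuous (lyapunovForcing D B) := by unfold lyapunovForcing; fun_prop
  let K : Set (Matrix (Fin n) (Fin n) ℝ) := {Y | Y ∈ symmetricWithRangeIn V ∧ Y.PosSemidef ∧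
    (P - Y).PosSemidef ∧ (lyapunovOperator A Y + lyapunovForcing D B Y).PosSemidef}
  have hcl : IsClosed K :=
    ((symmetricWithRangeIn V).closed_of_finiteDimensional).inter
      (isClosed_setOf_posSemidef.inter
        ((isClosed_setOf_posSemidef.preimage (by fun_prop : Continuous fun Y => P - Y)).inter
          (isClosed_setOf_posSemidef.preimage (hLc.add hGc))))
  have h0 : (0 : Matrix (Fin n) (Fin n) ℝ) ∈ K := by
    refine ⟨Submodule.zero_mem _, PosSemidef.zero, by simpa using hP, ?_⟩
    simp only [map_zero, zero_add, lyapunovForcing, mul_zero, zero_mul]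
    exact posSemidef_sum _ fun j _ => posSemidef_self_mul_conjTranspose (B j)
  obtain ⟨Y, hYK, hmax⟩ := exists_maximal_posSemidef (P := P) ⟨0, h0⟩ hcl fun Y hY => ⟨hY.2.1, hY.2.2.1⟩
  obtain ⟨hYV, hY0, hYP, hYF⟩ := hYK
  obtain ⟨Z, hZV, hZ⟩ := hA.exists_lyapunov_eq hAV
    (Submodule.neg_mem _ (lyapunovForcing_mem hDV hBV hYV))
  have hpos : ∀ X : Matrix (Fin n) (Fin n) ℝ, Xᵀ = X → (-(lyapunovOperator A X)).PosSemidef →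
      X.PosSemidef := fun X hX h =>
    .of_dotProduct_mulVec_nonneg hX fun x => hA.dotProduct_mulVec_nonneg_of_lyapunov h x
  have hPt : Pᵀ = P := hP.1
  -- -L(Z - Y) = L Y + G Y ≥ 0. Below, -L(P - Z) = G P - G Y and L Z + G Z = G Z - G Y are
  -- nonnegative by monotonicity of G.
  have hZY : (Z - Y).PosSemidef := by
    refine hpos _ (by rw [transpose_sub, hZV.1, hYV.1]) ?_
    convert hYF using 1
    rw [map_sub, hZ]; abel
  have hPZ : (P - Z).PosSemidef := by
    refine hpos _ (by rw [transpose_sub, hZV.1, hPt]) ?_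
    convert hYP.lyapunovForcing_sub (D := D) B using 1
    rw [map_sub, hZ, eq_neg_of_add_eq_zero_left heq]; abel
  have hZK : Z ∈ K := by
    refine ⟨hZV, ?_, hPZ, ?_⟩
    · simpa using hZY.add hY0
    · convert hZY.lyapunovForcing_sub (D := D) B using 1
      rw [hZ]; abel
  have hZeq : Z = Y := hmax Z hZK hZY
  have hYeq : Y = P := huniq Y hY0 (by rw [← hZeq, hZ, hZeq, neg_add_cancel])
  rw [← hYeq]
  exact hYV.2 x

/-- In xᵀ(equation)x the two terms with A vanish and the rest is a sum of squares and values of the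
form of P, so each summand is 0. -/
theorem ker_of_generalized_lyapunov {A : Matrix (Fin n) (Fin n) ℝ}
    {D : ι → Matrix (Fin n) (Fin n) ℝ} {B : ι → Matrix (Fin n) (Fin m) ℝ}
    {P : Matrix (Fin n) (Fin n) ℝ} (hP : P.PosSemidef)
    (heq : A * P + P * Aᵀ + lyapunovForcing D B P = 0) {x : Fin n → ℝ} (hx : P *ᵥ x = 0) :
    P *ᵥ (Aᵀ *ᵥ x) = 0 ∧ ∀ j, P *ᵥ ((D j)ᵀ *ᵥ x) = 0 ∧ (B j)ᵀ *ᵥ x = 0 := by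
  have hPt : Pᵀ = P := hP.1
  have hxP : x ᵥ* P = 0 := by rw [← mulVec_transpose, hPt, hx]
  have hterm : ∀ j, x ⬝ᵥ (D j * P * (D j)ᵀ + B j * (B j)ᵀ) *ᵥ x =
      ((D j)ᵀ *ᵥ x) ⬝ᵥ P *ᵥ ((D j)ᵀ *ᵥ x) + ((B j)ᵀ *ᵥ x) ⬝ᵥ ((B j)ᵀ *ᵥ x) := fun j => by
    rw [add_mulVec, dotProduct_add, dotProduct_mul_mul_transpose_mulVec]
    have := dotProduct_mul_mul_transpose_mulVec (B j) 1 x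
    rw [Matrix.mul_one, one_mulVec] at this
    rw [this]
  have h1 : ∀ j, 0 ≤ ((D j)ᵀ *ᵥ x) ⬝ᵥ P *ᵥ ((D j)ᵀ *ᵥ x) :=
    fun j => hP.dotProduct_mulVec_nonneg _
  have h2 : ∀ j, 0 ≤ ((B j)ᵀ *ᵥ x) ⬝ᵥ ((B j)ᵀ *ᵥ x) :=
    fun j => Finset.sum_nonneg fun i _ => mul_self_nonneg _
  have hsum : ∑ j, (((D j)ᵀ *ᵥ x) ⬝ᵥ P *ᵥ ((D j)ᵀ *ᵥ x) +
      ((B j)ᵀ *ᵥ x) ⬝ᵥ ((B j)ᵀ *ᵥ x)) = 0 := by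
    have h3 := congrArg (fun X => x ⬝ᵥ X *ᵥ x) heq
    simp only [add_mulVec, dotProduct_add, lyapunovForcing, sum_mulVec, dotProduct_sum,
      zero_mulVec, dotProduct_zero, ← mulVec_mulVec, hx, mulVec_zero, zero_add] at h3
    simp only [add_mulVec, dotProduct_add, ← mulVec_mulVec] at hterm
    rw [dotProduct_mulVec x P, hxP, zero_dotProduct, zero_add] at h3
    simpa only [hterm] using h3
  rw [Finset.sum_eq_zero_iff_of_nonneg fun j _ => add_nonneg (h1 j) (h2 j)] at hsum
  have hDB : ∀ j, P *ᵥ ((D j)ᵀ *ᵥ x) = 0 ∧ (B j)ᵀ *ᵥ x = 0 := fun j => by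
    have h3 := hsum j (Finset.mem_univ j)
    refine ⟨(hP.dotProduct_mulVec_zero_iff _).1 ?_, dotProduct_self_eq_zero.1 ?_⟩
    · rw [star_trivial]; linarith [h1 j, h2 j]
    · linarith [h1 j, h2 j]
  refine ⟨?_, hDB⟩
  -- Applied to x, every term of the equation except P Aᵀ x is now known to vanish.
  have h4 := congrArg (fun X => X *ᵥ x) heq
  simpa [add_mulVec, lyapunovForcing, sum_mulVec, ← mulVec_mulVec, hx, hDB] using h4

/-- A vector orthogonal to the annihilator of a subspace belongs to the subspace. -/
theorem Submodule.mem_of_forall_dotProduct_eq_zero (V : Submodule ℝ (Fin n → ℝ)) {y : Fin n → ℝ}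
    (h : ∀ x, (∀ v ∈ V, x ⬝ᵥ v = 0) → x ⬝ᵥ y = 0) : y ∈ V := by
  by_contra hy
  obtain ⟨f, hfy, hfV⟩ := Submodule.exists_le_ker_of_notMem hy
  have hf : ∀ z, f z = (fun i => f (Pi.single i 1)) ⬝ᵥ z := fun z => by
    conv_lhs => rw [pi_eq_sum_univ' z]
    simp [dotProduct, map_sum, mul_comm]
  exact hfy (by rw [hf]; exact h _ fun v hv => by rw [← hf]; exact hfV hv)

theorem Matrix.mem_range_mulVecLin_of_forall_ker {P : Matrix (Fin n) (Fin n) ℝ} (hP : Pᵀ = P)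
    {y : Fin n → ℝ} (h : ∀ x, P *ᵥ x = 0 → x ⬝ᵥ y = 0) : y ∈ LinearMap.range P.mulVecLin := by
  refine Submodule.mem_of_forall_dotProduct_eq_zero _ fun x hx => h x ?_
  have h1 : ∀ z, (P *ᵥ x) ⬝ᵥ z = 0 := fun z => by
    have := hx (P *ᵥ z) ⟨z, rfl⟩
    rwa [dotProduct_mulVec, ← mulVec_transpose, hP] at this
  exact dotProduct_self_eq_zero.1 (h1 _)

theorem Matrix.dotProduct_mulVec_eq_zero_of_ker {P : Matrix (Fin n) (Fin n) ℝ} (hP : Pᵀ = P)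
    {x : Fin n → ℝ} (hx : P *ᵥ x = 0) (z : Fin n → ℝ) : x ⬝ᵥ P *ᵥ z = 0 := by
  rw [dotProduct_mulVec, ← mulVec_transpose, hP, hx, zero_dotProduct]

/-- The range of a solution of the generalized Lyapunov equation is invariant. -/
theorem range_of_generalized_lyapunov {A : Matrix (Fin n) (Fin n) ℝ}
    {D : ι → Matrix (Fin n) (Fin n) ℝ} {B : ι → Matrix (Fin n) (Fin m) ℝ}
    {P : Matrix (Fin n) (Fin n) ℝ} (hP : P.PosSemidef)
    (heq : A * P + P * Aᵀ + lyapunovForcing D B P = 0) :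
    (∀ x ∈ LinearMap.range P.mulVecLin, A *ᵥ x ∈ LinearMap.range P.mulVecLin) ∧
    (∀ j, ∀ x ∈ LinearMap.range P.mulVecLin, D j *ᵥ x ∈ LinearMap.range P.mulVecLin) ∧
    ∀ j v, B j *ᵥ v ∈ LinearMap.range P.mulVecLin := by
  have hPt : Pᵀ = P := hP.1
  have hinv : ∀ X : Matrix (Fin n) (Fin n) ℝ, (∀ x, P *ᵥ x = 0 → P *ᵥ (Xᵀ *ᵥ x) = 0) →
      ∀ x ∈ LinearMap.range P.mulVecLin, X *ᵥ x ∈ LinearMap.range P.mulVecLin := by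
    rintro X hX _ ⟨z, rfl⟩
    refine mem_range_mulVecLin_of_forall_ker hPt fun x hx => ?_
    rw [dotProduct_mulVec, ← mulVec_transpose]
    exact dotProduct_mulVec_eq_zero_of_ker hPt (hX x hx) z
  refine ⟨hinv A fun x hx => (ker_of_generalized_lyapunov hP heq hx).1,
    fun j => hinv (D j) fun x hx => ((ker_of_generalized_lyapunov hP heq hx).2 j).1, fun j v => ?_⟩
  refine mem_range_mulVecLin_of_forall_ker hPt fun x hx => ?_
  rw [dotProduct_mulVec, ← mulVec_transpose, ((ker_of_generalized_lyapunov hP heq hx).2 j).2,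
    zero_dotProduct]

end Gramian

/-! ### Switching signals: concatenation, measurability, integrability -/

section Switching

variable {M : ℕ}

theorem IsSwitchingSignalOn.mono {T T' : ℝ} {q : ℝ → Fin M} (hq : IsSwitchingSignalOn T q)
    (hT : T' ≤ T) : IsSwitchingSignalOn T' q := by
  obtain ⟨S, hS⟩ := hq
  exact ⟨S, fun a b ha hb => hS a b ha (hb.trans hT)⟩

theorem isSwitchingSignalOn_const (T : ℝ) (j : Fin M) : IsSwitchingSignalOn T fun _ => j :=
  ⟨∅, fun _ _ _ _ _ _ _ _ _ => rfl⟩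

/-- Following one function of time up to time `T` and another one afterwards. -/
noncomputable def concatAt {α : Type*} (T : ℝ) (f g : ℝ → α) (s : ℝ) : α :=
  if s < T then f s else g (s - T)

theorem IsSwitchingSignalOn.concat {T₁ T₂ : ℝ} {q₁ q₂ : ℝ → Fin M}
    (h₁ : IsSwitchingSignalOn T₁ q₁) (h₂ : IsSwitchingSignalOn T₂ q₂) :
    IsSwitchingSignalOn (T₁ + T₂) (concatAt T₁ q₁ q₂) := by
  classical
  obtain ⟨S₁, hS₁⟩ := h₁
  obtain ⟨S₂, hS₂⟩ := h₂
  -- The junction is itself a break point, so no interval of constancy straddles it.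
  refine ⟨insert T₁ (S₁ ∪ S₂.image (· + T₁)), fun a b ha hb hS s hs t ht => ?_⟩
  have hT := hS T₁ (Finset.mem_insert_self _ _)
  rcases le_or_gt b T₁ with hbT | hbT
  · simp only [concatAt, hs.2.trans_le hbT, ht.2.trans_le hbT, if_true]
    exact hS₁ a b ha hbT (fun r hr => hS r (by simp [hr])) s hs t ht
  · have haT : T₁ ≤ a := not_lt.1 fun h => hT ⟨h, hbT⟩
    simp only [concatAt, (haT.trans hs.1.le).not_gt, (haT.trans ht.1.le).not_gt, if_false]
    refine hS₂ (a - T₁) (b - T₁) (by linarith) (by linarith) (fun r hr hr' => ?_) _ ?_ _ ?_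
    · refine hS (r + T₁) (by simp [hr]) ⟨by linarith [hr'.1], by linarith [hr'.2]⟩
    · exact ⟨by linarith [hs.1], by linarith [hs.2]⟩
    · exact ⟨by linarith [ht.1], by linarith [ht.2]⟩

theorem IsSwitchingSignalOn.aestronglyMeasurable {T : ℝ} {q : ℝ → Fin M}
    (hq : IsSwitchingSignalOn T q) :
    AEStronglyMeasurable q (volume.restrict (Set.Ioc 0 T)) := by
  obtain ⟨S, hS⟩ := hq
  have hopen : IsOpen (Set.Ioo 0 T \ (S : Set ℝ)) := isOpen_Ioo.sdiff S.finite_toSet.isClosed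
  have hcont : ContinuousOn q (Set.Ioo 0 T \ (S : Set ℝ)) := by
    intro s hs
    obtain ⟨ε, hε, hball⟩ := Metric.isOpen_iff.1 hopen s hs
    rw [Real.ball_eq_Ioo] at hball
    have h0 : s - ε / 2 ∈ Set.Ioo (s - ε) (s + ε) := ⟨by linarith, by linarith⟩
    have h1 : s + ε / 2 ∈ Set.Ioo (s - ε) (s + ε) := ⟨by linarith, by linarith⟩
    have hsub : Set.Ioo (s - ε / 2) (s + ε / 2) ⊆ Set.Ioo (s - ε) (s + ε) :=
      Set.Ioo_subset_Ioo (by linarith) (by linarith)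
    refine ContinuousAt.continuousWithinAt (continuousAt_const.congr (f := fun _ => q s) ?_)
    filter_upwards [Ioo_mem_nhds (show s - ε / 2 < s by linarith) (show s < s + ε / 2 by linarith)]
      with t ht
    exact hS (s - ε / 2) (s + ε / 2) (hball h0).1.1.le (hball h1).1.2.le
      (fun r hr hr' => (hball (hsub hr')).2 hr) s ⟨by linarith, by linarith⟩ t ht
  have hae : (Set.Ioo 0 T \ (S : Set ℝ) : Set ℝ) =ᵐ[volume] Set.Ioc 0 T :=
    (sdiff_null_ae_eq_self (S.finite_toSet.measure_zero _)).trans Ioo_ae_eq_Ioc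
  rw [← Measure.restrict_congr_set hae]
  exact hcont.aestronglyMeasurable hopen.measurableSet

theorem IsSwitchingSignalOn.intervalIntegrable_clm {E F : Type*} [NormedAddCommGroup E]
    [NormedSpace ℝ E] [NormedAddCommGroup F] [NormedSpace ℝ F] {T : ℝ} {q : ℝ → Fin M}
    (hq : IsSwitchingSignalOn T q) (hT : 0 ≤ T) (a : Fin M → F →L[ℝ] E) {h : ℝ → F}
    (hh : IntervalIntegrable h volume 0 T) :
    IntervalIntegrable (fun s => a (q s) (h s)) volume 0 T := by
  rw [intervalIntegrable_iff_integrableOn_Ioc_of_le hT] at hh ⊢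
  have hmeas : AEStronglyMeasurable (fun s => a (q s)) (volume.restrict (Set.Ioc 0 T)) :=
    (continuous_of_discreteTopology (f := a)).comp_aestronglyMeasurable hq.aestronglyMeasurable
  refine Integrable.mono' (hh.norm.const_mul (∑ j, ‖a j‖))
    (isBoundedBilinearMap_apply.continuous.comp_aestronglyMeasurable
      (hmeas.prodMk hh.aestronglyMeasurable)) (.of_forall fun s => ?_)
  refine ((a (q s)).le_opNorm _).trans (mul_le_mul_of_nonneg_right ?_ (norm_nonneg _))
  exact Finset.single_le_sum (f := fun j => ‖a j‖) (fun j _ => norm_nonneg _) (Finset.mem_univ _)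

theorem IsSwitchingSignalOn.intervalIntegrable_mulVec {k l : ℕ} {T : ℝ} {q : ℝ → Fin M}
    (hq : IsSwitchingSignalOn T q) (hT : 0 ≤ T) (a : Fin M → Matrix (Fin k) (Fin l) ℝ)
    {h : ℝ → Fin l → ℝ} (hh : IntervalIntegrable h volume 0 T) :
    IntervalIntegrable (fun s => a (q s) *ᵥ h s) volume 0 T :=
  hq.intervalIntegrable_clm hT (fun j => (a j).mulVecLin.toContinuousLinearMap) hh

end Switching

/-! ### Grönwall's lemma, invariant subspaces and uniqueness of trajectories -/

open Set in
/-- Grönwall's lemma in integral form, with zero initial value. -/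
theorem eq_zero_of_norm_le_mul_integral {E : Type*} [NormedAddCommGroup E] {w : ℝ → E} {K T : ℝ}
    (hw : ContinuousOn w (Icc 0 T)) (h : ∀ t ∈ Icc 0 T, ‖w t‖ ≤ K * ∫ s in (0 : ℝ)..t, ‖w s‖) :
    ∀ t ∈ Icc 0 T, w t = 0 := by
  intro t ht
  have hT : 0 ≤ T := ht.1.trans ht.2
  -- Extending the norm continuously to the whole line makes its primitive differentiable
  -- everywhere, endpoints included.
  set v : ℝ → ℝ := IccExtend hT ((Icc 0 T).domRestrict fun s => ‖w s‖) with hv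
  have hvc : Continuous v := (continuousOn_iff_continuous_domRestrict.1 hw.norm).Icc_extend'
  have hvw : ∀ s ∈ Icc 0 T, v s = ‖w s‖ := fun s hs => IccExtend_of_mem hT _ hs
  have hint : ∀ r ∈ Icc 0 T, ∫ s in (0 : ℝ)..r, ‖w s‖ = ∫ s in (0 : ℝ)..r, v s := fun r hr => by
    refine intervalIntegral.integral_congr fun s hs => ?_
    rw [uIcc_of_le hr.1] at hs
    exact (hvw s ⟨hs.1, hs.2.trans hr.2⟩).symm
  have hder : ∀ r, HasDerivAt (fun r => ∫ s in (0 : ℝ)..r, v s) (v r) r :=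
    fun r => (hvc.integral_hasStrictDerivAt 0 r).hasDerivAt
  have hzero := eq_zero_of_abs_deriv_le_mul_abs_self_of_eq_zero_right (K := K) (a := 0) (b := T)
    (fun r _ => (hder r).continuousAt.continuousWithinAt)
    (fun r _ => (hder r).hasDerivWithinAt) intervalIntegral.integral_same (fun r hr => by
      have hr' : r ∈ Icc 0 T := Ico_subset_Icc_self hr
      have h0 : 0 ≤ ∫ s in (0 : ℝ)..r, ‖w s‖ :=
        intervalIntegral.integral_nonneg hr.1 fun s _ => norm_nonneg _
      rw [← hint r hr', hvw r hr', Real.norm_of_nonneg (norm_nonneg _), Real.norm_of_nonneg h0]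
      exact h r hr')
  have h1 := h t ht
  rw [hint t ht, hzero t ht, mul_zero] at h1
  exact norm_le_zero_iff.1 h1

/-- Every subspace is the kernel of a linear projection. -/
theorem Submodule.exists_clm_ker_eq {n : ℕ} (V : Submodule ℝ (Fin n → ℝ)) :
    ∃ f : (Fin n → ℝ) →L[ℝ] (Fin n → ℝ), (∀ x, f x = 0 ↔ x ∈ V) ∧ ∀ x, x - f x ∈ V := by
  obtain ⟨g, hg⟩ := LinearMap.exists_leftInverse_of_injective V.subtype V.ker_subtype
  refine ⟨(LinearMap.id - V.subtype ∘ₗ g).toContinuousLinearMap, fun x => ⟨fun h => ?_, fun h => ?_⟩,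
    fun x => ?_⟩
  · have h' : x = (g x : Fin n → ℝ) := sub_eq_zero.1 h
    rw [h']; exact (g x).2
  · have := LinearMap.congr_fun hg ⟨x, h⟩
    have h2 : g x = ⟨x, h⟩ := this
    simp [h2]
  · simp

namespace LSS

variable {n m p M : ℕ} {sys : LSS n m p M} {T : ℝ} {q : ℝ → Fin M}

theorem IsTrajectoryOn.intervalIntegrable {x₀ : Fin n → ℝ} {u : ℝ → Fin m → ℝ} {φ : ℝ → Fin n → ℝ}
    (h : sys.IsTrajectoryOn T x₀ u q φ) (hq : IsSwitchingSignalOn T q) (hu : IsInputOn T u)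
    {t : ℝ} (ht : t ∈ Set.Icc 0 T) :
    IntervalIntegrable (fun s => sys.A (q s) *ᵥ φ s + sys.B (q s) *ᵥ u s) volume 0 t := by
  have hT : 0 ≤ T := ht.1.trans ht.2
  have hφ : IntervalIntegrable φ volume 0 T := by
    refine ContinuousOn.intervalIntegrable ?_
    rw [Set.uIcc_of_le hT]
    exact h.continuousOn
  refine ((hq.intervalIntegrable_mulVec hT _ hφ).add
    (hq.intervalIntegrable_mulVec hT _ hu)).mono_set ?_
  rw [Set.uIcc_of_le hT, Set.uIcc_of_le ht.1]
  exact Set.Icc_subset_Icc_right ht.2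

theorem IsTrajectoryOn.add_smul {x₀ x₀' : Fin n → ℝ} {u u' : ℝ → Fin m → ℝ}
    {φ φ' : ℝ → Fin n → ℝ} (h : sys.IsTrajectoryOn T x₀ u q φ)
    (h' : sys.IsTrajectoryOn T x₀' u' q φ') (hq : IsSwitchingSignalOn T q)
    (hu : IsInputOn T u) (hu' : IsInputOn T u') (c : ℝ) :
    sys.IsTrajectoryOn T (x₀ + c • x₀') (u + c • u') q (φ + c • φ') := by
  refine ⟨h.continuousOn.add (h'.continuousOn.const_smul c), fun t ht => ?_⟩
  have h1 := h.intervalIntegrable hq hu ht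
  have h2 := h'.intervalIntegrable hq hu' ht
  simp only [Pi.add_apply, Pi.smul_apply]
  rw [h.eq_integral t ht, h'.eq_integral t ht]
  have h3 : ∀ s, sys.A (q s) *ᵥ (φ s + c • φ' s) + sys.B (q s) *ᵥ (u s + c • u' s) =
      (sys.A (q s) *ᵥ φ s + sys.B (q s) *ᵥ u s) +
        c • (sys.A (q s) *ᵥ φ' s + sys.B (q s) *ᵥ u' s) := fun s => by
    simp only [mulVec_add, mulVec_smul, smul_add]; abel
  simp only [h3]
  have h4 : IntervalIntegrable
      (fun s => c • (sys.A (q s) *ᵥ φ' s + sys.B (q s) *ᵥ u' s)) volume 0 t := h2.smul c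
  rw [intervalIntegral.integral_add h1 h4, intervalIntegral.integral_smul, smul_add]
  abel

/-- Trajectories do not leave a subspace that is invariant under all modes and contains the values
of the forcing term. -/
theorem IsTrajectoryOn.mem_of_invariant {V : Submodule ℝ (Fin n → ℝ)} {x₀ : Fin n → ℝ}
    {u : ℝ → Fin m → ℝ} {φ : ℝ → Fin n → ℝ} (h : sys.IsTrajectoryOn T x₀ u q φ)
    (hq : IsSwitchingSignalOn T q) (hu : IsInputOn T u) (hA : ∀ j, ∀ x ∈ V, sys.A j *ᵥ x ∈ V)
    (hB : ∀ j s, sys.B j *ᵥ u s ∈ V) (hx₀ : x₀ ∈ V) {t : ℝ} (ht : t ∈ Set.Icc 0 T) : φ t ∈ V := by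
  obtain ⟨f, hfV, hf⟩ := V.exists_clm_ker_eq
  let a : Fin M → (Fin n → ℝ) →L[ℝ] (Fin n → ℝ) :=
    fun j => f.comp (sys.A j).mulVecLin.toContinuousLinearMap
  -- Since x - f x lies in V, which is invariant and equals ker f, the component f(φ) obeys a closed
  -- homogeneous equation.
  have ha : ∀ j x, f (sys.A j *ᵥ x) = a j (f x) := fun j x => by
    have h1 := (hfV _).2 (hA j _ (hf x))
    rw [mulVec_sub, map_sub, sub_eq_zero] at h1
    exact h1
  have hw : ∀ t ∈ Set.Icc 0 T, f (φ t) = ∫ s in (0 : ℝ)..t, a (q s) (f (φ s)) := fun t ht => by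
    rw [h.eq_integral t ht, map_add, (hfV _).2 hx₀, zero_add,
      ← ContinuousLinearMap.intervalIntegral_comp_comm _ (h.intervalIntegrable hq hu ht)]
    refine intervalIntegral.integral_congr fun s _ => ?_
    simp only [map_add, ha, (hfV _).2 (hB (q s) s), add_zero]
  have hcont : ContinuousOn (fun t => f (φ t)) (Set.Icc 0 T) :=
    f.continuous.comp_continuousOn h.continuousOn
  refine (hfV _).1 (eq_zero_of_norm_le_mul_integral (K := ∑ j, ‖a j‖) hcont (fun t ht => ?_) t ht)
  rw [hw t ht, ← intervalIntegral.integral_const_mul]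
  refine intervalIntegral.norm_integral_le_of_norm_le ht.1 (.of_forall fun s _ => ?_) ?_
  · refine ((a (q s)).le_opNorm _).trans (mul_le_mul_of_nonneg_right ?_ (norm_nonneg _))
    exact Finset.single_le_sum (f := fun j => ‖a j‖) (fun j _ => norm_nonneg _) (Finset.mem_univ _)
  · refine ContinuousOn.intervalIntegrable ?_
    rw [Set.uIcc_of_le ht.1]
    exact continuousOn_const.mul (hcont.norm.mono (Set.Icc_subset_Icc_right ht.2))

theorem IsTrajectoryOn.unique {x₀ : Fin n → ℝ} {u : ℝ → Fin m → ℝ} {φ φ' : ℝ → Fin n → ℝ}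
    (h : sys.IsTrajectoryOn T x₀ u q φ) (h' : sys.IsTrajectoryOn T x₀ u q φ')
    (hq : IsSwitchingSignalOn T q) (hu : IsInputOn T u) {t : ℝ} (ht : t ∈ Set.Icc 0 T) :
    φ t = φ' t := by
  have h1 := h.add_smul h' hq hu hu (-1)
  have hu0 : u + (-1 : ℝ) • u = 0 := by simp
  rw [hu0] at h1
  have h2 := h1.mem_of_invariant (V := ⊥) hq IntervalIntegrable.zero (by simp) (by simp)
    (by simp) ht
  simpa [← sub_eq_add_neg, sub_eq_zero] using h2

end LSS

/-! ### Concatenation of functions of time -/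

section Concat

theorem concatAt_of_lt {α : Type*} {T s : ℝ} (f g : ℝ → α) (h : s < T) : concatAt T f g s = f s :=
  if_pos h

theorem concatAt_of_le {α : Type*} {T s : ℝ} (f g : ℝ → α) (h : T ≤ s) :
    concatAt T f g s = g (s - T) :=
  if_neg h.not_gt

variable {E : Type*} {f g : ℝ → E} {T₁ T₂ s : ℝ}

theorem ae_eq_concatAt_left (f g : ℝ → E) (h₀ : 0 ≤ s) (hs : s ≤ T₁) :
    ∀ᵐ r, r ∈ Set.uIoc 0 s → f r = concatAt T₁ f g r := by
  -- At the junction itself `concatAt` takes the value of the second function, so one point must be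
  -- discarded.
  filter_upwards [compl_mem_ae_iff.2 (measure_singleton (μ := volume) T₁)] with r hr hrs
  rw [Set.uIoc_of_le h₀] at hrs
  exact (concatAt_of_lt f g (lt_of_le_of_ne (hrs.2.trans hs) hr)).symm

theorem eq_concatAt_right (f g : ℝ → E) (hs : T₁ ≤ s) :
    ∀ r ∈ Set.uIoc T₁ s, g (r - T₁) = concatAt T₁ f g r := by
  intro r hr
  rw [Set.uIoc_of_le hs] at hr
  exact (concatAt_of_le f g hr.1.le).symm

variable [NormedAddCommGroup E]

theorem continuousOn_concatAt (hf : ContinuousOn f (Set.Icc 0 T₁)) (hg : ContinuousOn g (Set.Icc 0 T₂))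
    (hfg : f T₁ = g 0) : ContinuousOn (concatAt T₁ f g) (Set.Icc 0 (T₁ + T₂)) := by
  have hl : ContinuousOn (concatAt T₁ f g) (Set.Icc 0 T₁) := hf.congr fun r hr => by
    rcases hr.2.lt_or_eq with h | h
    · exact concatAt_of_lt f g h
    · rw [concatAt_of_le f g h.ge, h, sub_self, hfg]
  have hr : ContinuousOn (concatAt T₁ f g) (Set.Icc T₁ (T₁ + T₂)) := by
    refine (hg.comp (f := fun r => r - T₁) (by fun_prop) fun r hr => ?_).congr
      fun r hr => concatAt_of_le f g hr.1
    exact ⟨by linarith [hr.1], by linarith [hr.2]⟩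
  refine (hl.union_of_isClosed hr isClosed_Icc isClosed_Icc).mono fun r hr => ?_
  rcases le_total r T₁ with h | h
  · exact Or.inl ⟨hr.1, h⟩
  · exact Or.inr ⟨h, hr.2⟩

theorem intervalIntegrable_concatAt_left (g : ℝ → E) (hf : IntervalIntegrable f volume 0 T₁)
    (h₁ : 0 ≤ T₁) : IntervalIntegrable (concatAt T₁ f g) volume 0 T₁ :=
  hf.congr_ae ((ae_restrict_iff' measurableSet_uIoc).2 (ae_eq_concatAt_left f g h₁ le_rfl))

theorem intervalIntegrable_concatAt_right (f : ℝ → E) (hs : T₁ ≤ s)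
    (hg : IntervalIntegrable g volume 0 (s - T₁)) :
    IntervalIntegrable (concatAt T₁ f g) volume T₁ s := by
  have h := hg.comp_sub_right T₁
  rw [zero_add, sub_add_cancel] at h
  exact h.congr (eq_concatAt_right f g hs)

theorem intervalIntegrable_concatAt (hf : IntervalIntegrable f volume 0 T₁)
    (hg : IntervalIntegrable g volume 0 T₂) (h₁ : 0 ≤ T₁) (h₂ : 0 ≤ T₂) :
    IntervalIntegrable (concatAt T₁ f g) volume 0 (T₁ + T₂) :=
  (intervalIntegrable_concatAt_left g hf h₁).trans
    (intervalIntegrable_concatAt_right f (by linarith) (by simpa using hg))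

variable [NormedSpace ℝ E]

theorem integral_concatAt_of_le (f g : ℝ → E) (h₀ : 0 ≤ s) (hs : s ≤ T₁) :
    ∫ r in (0 : ℝ)..s, concatAt T₁ f g r = ∫ r in (0 : ℝ)..s, f r :=
  (intervalIntegral.integral_congr_ae (ae_eq_concatAt_left f g h₀ hs)).symm

theorem integral_concatAt (hf : IntervalIntegrable f volume 0 T₁) (h₁ : 0 ≤ T₁) (hs : T₁ ≤ s)
    (hg : IntervalIntegrable g volume 0 (s - T₁)) :
    ∫ r in (0 : ℝ)..s, concatAt T₁ f g r =
      (∫ r in (0 : ℝ)..T₁, f r) + ∫ r in (0 : ℝ)..(s - T₁), g r := by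
  rw [← intervalIntegral.integral_add_adjacent_intervals
    (intervalIntegrable_concatAt_left g hf h₁) (intervalIntegrable_concatAt_right f hs hg),
    integral_concatAt_of_le f g h₁ le_rfl,
    ← intervalIntegral.integral_congr_ae (.of_forall (eq_concatAt_right f g hs)),
    intervalIntegral.integral_comp_sub_right, sub_self]

end Concat

/-! ### The exponential flow and its integral -/

section ExpFlow

variable {E : Type*} [NormedAddCommGroup E] [NormedSpace ℝ E]

/-- The integral `∫₀ᵗ exp(s a) ds`. -/
noncomputable def expIntegral (a : E →L[ℝ] E) (t : ℝ) : E →L[ℝ] E :=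
  ∫ s in (0 : ℝ)..t, NormedSpace.exp (s • a)

theorem expIntegral_zero (a : E →L[ℝ] E) : expIntegral a 0 = 0 := intervalIntegral.integral_same

variable [CompleteSpace E]

theorem continuous_exp_smul (a : E →L[ℝ] E) : Continuous fun t : ℝ => NormedSpace.exp (t • a) :=
  continuous_iff_continuousAt.2 fun t => (hasDerivAt_exp_smul_const a t).continuousAt

theorem hasDerivAt_expIntegral (a : E →L[ℝ] E) (t : ℝ) :
    HasDerivAt (expIntegral a) (NormedSpace.exp (t • a)) t :=
  ((continuous_exp_smul a).integral_hasStrictDerivAt 0 t).hasDerivAt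

/-- Both sides integrate the derivative of s ↦ exp(s a); `a` need not be invertible. -/
theorem mul_expIntegral (a : E →L[ℝ] E) (t : ℝ) :
    a * expIntegral a t = NormedSpace.exp (t • a) - 1 := by
  have h1 : ∫ s in (0 : ℝ)..t, a * NormedSpace.exp (s • a) = NormedSpace.exp (t • a) - 1 := by
    rw [intervalIntegral.integral_eq_sub_of_hasDerivAt
      (fun s _ => hasDerivAt_exp_smul_const' a s)
      ((continuous_const.mul (continuous_exp_smul a)).intervalIntegrable _ _), zero_smul,
      NormedSpace.exp_zero]
  rw [← h1]
  exact ((ContinuousLinearMap.mul ℝ (E →L[ℝ] E) a).intervalIntegral_comp_comm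
    ((continuous_exp_smul a).intervalIntegrable _ _)).symm

theorem hasDerivAt_exp_smul_apply (a : E →L[ℝ] E) (x : E) (t : ℝ) :
    HasDerivAt (fun t : ℝ => NormedSpace.exp (t • a) x) (a (NormedSpace.exp (t • a) x)) t := by
  simpa using (hasDerivAt_exp_smul_const' a t).clm_apply (hasDerivAt_const t x)

theorem hasDerivAt_expIntegral_apply (a : E →L[ℝ] E) (w : E) (t : ℝ) :
    HasDerivAt (fun t : ℝ => expIntegral a t w) (NormedSpace.exp (t • a) w) t := by
  simpa using (hasDerivAt_expIntegral a t).clm_apply (hasDerivAt_const t w)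

/-- The variation of constants formula for a constant forcing term. -/
theorem hasDerivAt_exp_add_expIntegral (a : E →L[ℝ] E) (x w : E) (t : ℝ) :
    HasDerivAt (fun t : ℝ => NormedSpace.exp (t • a) x + expIntegral a t w)
      (a (NormedSpace.exp (t • a) x + expIntegral a t w) + w) t := by
  refine ((hasDerivAt_exp_smul_apply a x t).add (hasDerivAt_expIntegral_apply a w t)).congr_deriv ?_
  have h := congrArg (fun b : E →L[ℝ] E => b w) (mul_expIntegral a t)
  have h' : a (expIntegral a t w) = NormedSpace.exp (t • a) w - w := h
  rw [map_add, h', add_assoc, sub_add_cancel]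

theorem exp_smul_injective (a : E →L[ℝ] E) (t : ℝ) :
    Function.Injective (NormedSpace.exp (t • a) : E →L[ℝ] E) := by
  let : NormedAlgebra ℚ (E →L[ℝ] E) := .restrictScalars ℚ ℝ _
  obtain ⟨u, hu⟩ := NormedSpace.isUnit_exp (t • a)
  refine Function.LeftInverse.injective (g := (↑u⁻¹ : E →L[ℝ] E)) fun z => ?_
  rw [← hu]
  exact congrArg (fun b : E →L[ℝ] E => b z) u.inv_mul

end ExpFlow

/-- The velocity of a curve that stays in a subspace for nonnegative times lies in the subspace. -/
theorem Submodule.mem_of_hasDerivAt {E : Type*} [NormedAddCommGroup E] [NormedSpace ℝ E]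
    [FiniteDimensional ℝ E] (V : Submodule ℝ E) {γ : ℝ → E} {v : E} (h : HasDerivAt γ v 0)
    (hγ : ∀ t, 0 ≤ t → γ t ∈ V) : v ∈ V := by
  have hcl : IsClosed (V : Set E) := V.closed_of_finiteDimensional
  refine hcl.mem_of_tendsto h.tendsto_slope_zero_right ?_
  filter_upwards [self_mem_nhdsWithin] with t ht
  exact V.smul_mem _ (V.sub_mem (hγ _ (by simpa using ht.le)) (hγ 0 le_rfl))

/-! ### Concatenated trajectories and an invariant subspace of reachable states -/

namespace LSS

variable {n m p M : ℕ} {sys : LSS n m p M}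

theorem IsTrajectoryOn.concat {T₁ T₂ : ℝ} {x₀ : Fin n → ℝ} {u₁ u₂ : ℝ → Fin m → ℝ}
    {q₁ q₂ : ℝ → Fin M} {φ₁ φ₂ : ℝ → Fin n → ℝ} (h₁ : sys.IsTrajectoryOn T₁ x₀ u₁ q₁ φ₁)
    (h₂ : sys.IsTrajectoryOn T₂ (φ₁ T₁) u₂ q₂ φ₂) (hT₁ : 0 ≤ T₁) (hT₂ : 0 ≤ T₂)
    (hq₁ : IsSwitchingSignalOn T₁ q₁) (hq₂ : IsSwitchingSignalOn T₂ q₂)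
    (hu₁ : IsInputOn T₁ u₁) (hu₂ : IsInputOn T₂ u₂) :
    sys.IsTrajectoryOn (T₁ + T₂) x₀ (concatAt T₁ u₁ u₂) (concatAt T₁ q₁ q₂)
      (concatAt T₁ φ₁ φ₂) := by
  have h0 : φ₂ 0 = φ₁ T₁ := by
    rw [h₂.eq_integral 0 ⟨le_rfl, hT₂⟩, intervalIntegral.integral_same, add_zero]
  refine ⟨continuousOn_concatAt h₁.continuousOn h₂.continuousOn h0.symm, fun t ht => ?_⟩
  have hint : ∀ s, sys.A (concatAt T₁ q₁ q₂ s) *ᵥ concatAt T₁ φ₁ φ₂ s +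
      sys.B (concatAt T₁ q₁ q₂ s) *ᵥ concatAt T₁ u₁ u₂ s =
      concatAt T₁ (fun s => sys.A (q₁ s) *ᵥ φ₁ s + sys.B (q₁ s) *ᵥ u₁ s)
        (fun s => sys.A (q₂ s) *ᵥ φ₂ s + sys.B (q₂ s) *ᵥ u₂ s) s := fun s => by
    unfold concatAt; split_ifs <;> rfl
  simp only [hint]
  rcases lt_or_ge t T₁ with hlt | hge
  · rw [integral_concatAt_of_le _ _ ht.1 hlt.le, concatAt_of_lt _ _ hlt]
    exact h₁.eq_integral t ⟨ht.1, hlt.le⟩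
  · have ht' : t - T₁ ∈ Set.Icc 0 T₂ := ⟨by linarith, by linarith [ht.2]⟩
    rw [integral_concatAt (h₁.intervalIntegrable hq₁ hu₁ ⟨hT₁, le_rfl⟩) hT₁ hge
      (h₂.intervalIntegrable hq₂ hu₂ ht'), concatAt_of_le _ _ hge, h₂.eq_integral _ ht',
      h₁.eq_integral T₁ ⟨hT₁, le_rfl⟩, add_assoc]

/-- The state matrix of a mode as a continuous linear map. -/
noncomputable def stateMap (sys : LSS n m p M) (j : Fin M) : (Fin n → ℝ) →L[ℝ] (Fin n → ℝ) :=
  (sys.A j).mulVecLin.toContinuousLinearMap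

theorem stateMap_apply (j : Fin M) (x : Fin n → ℝ) : sys.stateMap j x = sys.A j *ᵥ x := rfl

/-- The trajectory of a single mode for a constant input. -/
theorem isTrajectoryOn_const (sys : LSS n m p M) (T : ℝ) (j : Fin M) (x₀ : Fin n → ℝ)
    (v : Fin m → ℝ) :
    sys.IsTrajectoryOn T x₀ (fun _ => v) (fun _ => j) fun t =>
      NormedSpace.exp (t • sys.stateMap j) x₀ + expIntegral (sys.stateMap j) t (sys.B j *ᵥ v) := by
  have hder := hasDerivAt_exp_add_expIntegral (sys.stateMap j) x₀ (sys.B j *ᵥ v)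
  have hcont := continuous_iff_continuousAt.2 fun t => (hder t).continuousAt
  refine ⟨hcont.continuousOn, fun t _ => ?_⟩
  have h := intervalIntegral.integral_eq_sub_of_hasDerivAt (a := 0) (b := t) (fun s _ => hder s)
    ((((sys.stateMap j).continuous.comp hcont).add continuous_const).intervalIntegrable _ _)
  simp only [stateMap_apply] at h
  rw [h, zero_smul, NormedSpace.exp_zero, expIntegral_zero]
  simp

theorem zero_mem_reachableSet [NeZero M] (sys : LSS n m p M) : (0 : Fin n → ℝ) ∈ sys.reachableSet :=
  ⟨0, le_rfl, fun _ => 0, isSwitchingSignalOn_const _ _, fun _ => 0, IntervalIntegrable.zero, _,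
    sys.isTrajectoryOn_const 0 0 0 0, by simp [expIntegral_zero]⟩

theorem exp_add_expIntegral_mem_reachableSet {x : Fin n → ℝ} (hx : x ∈ sys.reachableSet)
    (j : Fin M) {t : ℝ} (ht : 0 ≤ t) (v : Fin m → ℝ) :
    NormedSpace.exp (t • sys.stateMap j) x + expIntegral (sys.stateMap j) t (sys.B j *ᵥ v) ∈
      sys.reachableSet := by
  obtain ⟨T, hT, q, hq, u, hu, φ, hφ, rfl⟩ := hx
  have hv : IsInputOn t fun _ : ℝ => v := intervalIntegrable_const
  refine ⟨T + t, by linarith, _, hq.concat (isSwitchingSignalOn_const t j), _,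
    intervalIntegrable_concatAt hu hv hT ht, _,
    hφ.concat (sys.isTrajectoryOn_const t j (φ T) v) hT ht hq (isSwitchingSignalOn_const t j) hu hv,
    ?_⟩
  rw [concatAt_of_le _ _ (by linarith), add_sub_cancel_left]

/-- The states reached from `0` along a list of modes and durations (the most recent first) with
inputs that are constant on each piece. -/
noncomputable def reachAlong (sys : LSS n m p M) :
    List (Fin M × NNReal) → Submodule ℝ (Fin n → ℝ)
  | [] => ⊥
  | (j, t) :: σ => (sys.reachAlong σ).map (NormedSpace.exp ((t : ℝ) • sys.stateMap j)).toLinearMap ⊔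
      LinearMap.range ((expIntegral (sys.stateMap j) t).toLinearMap ∘ₗ (sys.B j).mulVecLin)

/-- The state transition map along a list of modes and durations (the most recent first). -/
noncomputable def transitionAlong (sys : LSS n m p M) :
    List (Fin M × NNReal) → (Fin n → ℝ) →ₗ[ℝ] (Fin n → ℝ)
  | [] => LinearMap.id
  | (j, t) :: σ => (NormedSpace.exp ((t : ℝ) • sys.stateMap j)).toLinearMap ∘ₗ sys.transitionAlong σ

theorem transitionAlong_injective (sys : LSS n m p M) (σ : List (Fin M × NNReal)) :
    Function.Injective (sys.transitionAlong σ) := by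
  induction σ with
  | nil => exact Function.injective_id
  | cons a σ ih => exact (exp_smul_injective _ _).comp ih

/-- Lists run backwards in time: τ is followed first, its states are transported along σ, and the
inputs during σ add their own contribution. -/
theorem reachAlong_append (sys : LSS n m p M) (σ τ : List (Fin M × NNReal)) :
    sys.reachAlong (σ ++ τ) =
      (sys.reachAlong τ).map (sys.transitionAlong σ) ⊔ sys.reachAlong σ := by
  induction σ with
  | nil => simp [reachAlong, transitionAlong]
  | cons a σ ih =>
    rw [List.cons_append, reachAlong, ih, reachAlong, transitionAlong, Submodule.map_sup,
      ← Submodule.map_comp, sup_assoc]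

theorem reachAlong_subset_reachableSet [NeZero M] (sys : LSS n m p M)
    (σ : List (Fin M × NNReal)) : (sys.reachAlong σ : Set (Fin n → ℝ)) ⊆ sys.reachableSet := by
  induction σ with
  | nil =>
    intro x hx
    rw [(Submodule.mem_bot ℝ).1 hx]
    exact sys.zero_mem_reachableSet
  | cons a σ ih =>
    intro x hx
    obtain ⟨_, ⟨y, hy, rfl⟩, _, ⟨v, rfl⟩, rfl⟩ := Submodule.mem_sup.1 hx
    exact exp_add_expIntegral_mem_reachableSet (ih hy) a.1 a.2.2 v

/-- The reachable set contains a subspace that is invariant under all modes and contains the ranges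
of all input matrices. -/
theorem exists_invariant_subset_reachableSet [NeZero M] (sys : LSS n m p M) :
    ∃ W : Submodule ℝ (Fin n → ℝ), (W : Set (Fin n → ℝ)) ⊆ sys.reachableSet ∧
      (∀ j, ∀ x ∈ W, sys.A j *ᵥ x ∈ W) ∧ ∀ j v, sys.B j *ᵥ v ∈ W := by
  -- Minimizing the codimension selects a list whose reachable subspace has maximal dimension.
  let d : List (Fin M × NNReal) → ℕ := fun σ => n - Module.finrank ℝ (sys.reachAlong σ)
  let σ := Function.argmin d
  have hmax : ∀ τ, Module.finrank ℝ (sys.reachAlong τ) ≤ Module.finrank ℝ (sys.reachAlong σ) := by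
    intro τ
    have h1 : d σ ≤ d τ := Function.argmin_le d τ
    have h2 := (sys.reachAlong τ).finrank_le
    have h3 := (sys.reachAlong σ).finrank_le
    rw [Module.finrank_fin_fun] at h2 h3
    simp only [d] at h1
    omega
  -- Following σ after any τ cannot enlarge W, so σ transports every reachable subspace into W. For
  -- τ = σ this is a bijection of W by dimension, and it can be undone.
  set W := sys.reachAlong σ with hW
  have hmap : ∀ τ, (sys.reachAlong τ).map (sys.transitionAlong σ) ≤ W := fun τ => by
    have h1 := sys.reachAlong_append σ τ
    have h2 : W = sys.reachAlong (σ ++ τ) :=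
      Submodule.eq_of_le_of_finrank_le (by rw [h1]; exact le_sup_right) (hmax _)
    rw [h2, h1]
    exact le_sup_left
  have hσ : W.map (sys.transitionAlong σ) = W := by
    refine Submodule.eq_of_le_of_finrank_le (hmap σ) ?_
    exact (Submodule.equivMapOfInjective _ (sys.transitionAlong_injective σ) W).finrank_eq.le
  have hback : ∀ x, sys.transitionAlong σ x ∈ W → x ∈ W := fun x hx => by
    rw [← hσ] at hx
    obtain ⟨y, hy, hyx⟩ := hx
    rwa [← sys.transitionAlong_injective σ hyx]
  have hmem : ∀ τ, ∀ x ∈ sys.reachAlong τ, x ∈ W := fun τ x hx =>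
    hback x (hmap τ ⟨x, hx, rfl⟩)
  refine ⟨W, sys.reachAlong_subset_reachableSet σ, fun j x hx => ?_, fun j v => ?_⟩
  · have h := hasDerivAt_exp_smul_apply (sys.stateMap j) x 0
    rw [zero_smul, NormedSpace.exp_zero] at h
    refine W.mem_of_hasDerivAt h fun t ht => hmem ((j, ⟨t, ht⟩) :: σ) _ ?_
    exact Submodule.mem_sup_left ⟨x, hx, rfl⟩
  · have h := hasDerivAt_expIntegral_apply (sys.stateMap j) (sys.B j *ᵥ v) 0
    rw [zero_smul, NormedSpace.exp_zero] at h
    refine W.mem_of_hasDerivAt h fun t ht => hmem [(j, ⟨t, ht⟩)] _ ?_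
    exact Submodule.mem_sup_right ⟨v, rfl⟩

end LSS

/-! ### Zero input responses and the unobservable subspace -/

namespace LSS

variable {n m p M : ℕ}

/-- The terms of the Picard series of the zero input response. -/
noncomputable def picardTerm (sys : LSS n m p M) (q : ℝ → Fin M) (x₀ : Fin n → ℝ) :
    ℕ → ℝ → Fin n → ℝ
  | 0 => fun _ => x₀
  | k + 1 => fun t => ∫ s in (0 : ℝ)..t, sys.stateMap (q s) (sys.picardTerm q x₀ k s)

section Existence

variable (sys : LSS n m p M) {q : ℝ → Fin M} (x₀ : Fin n → ℝ) {T : ℝ}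

theorem norm_stateMap_le_sum (j : Fin M) : ‖sys.stateMap j‖ ≤ ∑ i, ‖sys.stateMap i‖ :=
  Finset.single_le_sum (f := fun i => ‖sys.stateMap i‖) (fun _ _ => norm_nonneg _)
    (Finset.mem_univ _)

theorem sum_norm_stateMap_nonneg : 0 ≤ ∑ i, ‖sys.stateMap i‖ :=
  Finset.sum_nonneg fun _ _ => norm_nonneg _

theorem continuousOn_picardTerm (hq : IsSwitchingSignalOn T q) (hT : 0 ≤ T) (k : ℕ) :
    ContinuousOn (sys.picardTerm q x₀ k) (Set.Icc 0 T) := by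
  induction k with
  | zero => exact continuousOn_const
  | succ k ih =>
    rw [← Set.uIcc_of_le hT] at ih ⊢
    exact intervalIntegral.continuousOn_primitive_interval'
      (hq.intervalIntegrable_clm hT sys.stateMap ih.intervalIntegrable) Set.left_mem_uIcc

/-- Each integration contributes a factor K t/(k + 1), so the exponential series is a majorant. The
bound must depend on t for the induction to integrate it. -/
theorem norm_picardTerm_le (k : ℕ) {t : ℝ} (ht : 0 ≤ t) :
    ‖sys.picardTerm q x₀ k t‖ ≤ ‖x₀‖ * (((∑ i, ‖sys.stateMap i‖) * t) ^ k / k.factorial) := by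
  induction k generalizing t with
  | zero => simp [picardTerm]
  | succ k ih =>
    set K := ∑ i, ‖sys.stateMap i‖ with hK
    have hle : ‖sys.picardTerm q x₀ (k + 1) t‖ ≤
        ∫ s in (0 : ℝ)..t, K * (‖x₀‖ * ((K * s) ^ k / k.factorial)) := by
      refine intervalIntegral.norm_integral_le_of_norm_le ht (.of_forall fun s hs => ?_)
        (Continuous.intervalIntegrable (by fun_prop) _ _)
      refine ((sys.stateMap (q s)).le_opNorm _).trans ?_
      exact mul_le_mul (sys.norm_stateMap_le_sum _) (ih hs.1.le) (norm_nonneg _)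
        sys.sum_norm_stateMap_nonneg
    refine hle.trans_eq ?_
    have h1 : ∀ s : ℝ, K * (‖x₀‖ * ((K * s) ^ k / k.factorial)) =
        (‖x₀‖ * K ^ (k + 1) / k.factorial) * s ^ k := fun s => by
      rw [mul_pow, pow_succ]; ring
    simp only [h1]
    rw [intervalIntegral.integral_const_mul, integral_pow, Nat.factorial_succ, mul_pow]
    push_cast
    have h2 : ((k : ℝ) + 1) ≠ 0 := by positivity
    have h3 : (k.factorial : ℝ) ≠ 0 := by positivity
    field_simp
    simp

theorem norm_picardTerm_le_of_mem (k : ℕ) {t : ℝ} (ht : t ∈ Set.Icc 0 T) :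
    ‖sys.picardTerm q x₀ k t‖ ≤ ‖x₀‖ * (((∑ i, ‖sys.stateMap i‖) * T) ^ k / k.factorial) := by
  refine (sys.norm_picardTerm_le x₀ k ht.1).trans ?_
  have h1 := sys.sum_norm_stateMap_nonneg
  have h2 := mul_le_mul_of_nonneg_left ht.2 h1
  have h3 := mul_nonneg h1 ht.1
  gcongr

/-- For every switching signal there is a global zero input response. -/
theorem exists_isTrajectoryOn_zero_input (hq : ∀ T : ℝ, 0 ≤ T → IsSwitchingSignalOn T q) :
    ∃ φ : ℝ → Fin n → ℝ, ∀ T : ℝ, 0 ≤ T → sys.IsTrajectoryOn T x₀ 0 q φ := by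
  set K := ∑ i, ‖sys.stateMap i‖ with hK
  have hsumm : ∀ T : ℝ, Summable fun k : ℕ => ‖x₀‖ * ((K * T) ^ k / k.factorial) :=
    fun T => (Real.summable_pow_div_factorial _).mul_left _
  have hφ : ∀ t, 0 ≤ t → Summable fun k => sys.picardTerm q x₀ k t := fun t ht =>
    .of_norm_bounded (hsumm t) fun k => sys.norm_picardTerm_le x₀ k ht
  refine ⟨fun t => ∑' k, sys.picardTerm q x₀ k t, fun T hT => ⟨?_, fun t ht => ?_⟩⟩
  · exact continuousOn_tsum (fun k => sys.continuousOn_picardTerm x₀ (hq T hT) hT k) (hsumm T)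
      fun k t ht => sys.norm_picardTerm_le_of_mem x₀ k ht
  · have hsum : HasSum (fun k => sys.picardTerm q x₀ (k + 1) t)
        (∫ s in (0 : ℝ)..t, sys.stateMap (q s) (∑' k, sys.picardTerm q x₀ k s)) := by
      refine intervalIntegral.hasSum_integral_of_dominated_convergence
        (fun k _ => K * (‖x₀‖ * ((K * t) ^ k / k.factorial))) (fun k => ?_) (fun k => ?_)
        (.of_forall fun s _ => (hsumm t).mul_left K) intervalIntegrable_const
        (.of_forall fun s hs => ?_)
      · have hc := sys.continuousOn_picardTerm x₀ (hq t ht.1) ht.1 k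
        rw [← Set.uIcc_of_le ht.1] at hc
        exact ((hq t ht.1).intervalIntegrable_clm ht.1 sys.stateMap
          hc.intervalIntegrable).def'.aestronglyMeasurable
      · refine .of_forall fun s hs => ?_
        rw [Set.uIoc_of_le ht.1] at hs
        refine ((sys.stateMap (q s)).le_opNorm _).trans ?_
        exact mul_le_mul (sys.norm_stateMap_le_sum _)
          (sys.norm_picardTerm_le_of_mem x₀ k (Set.Ioc_subset_Icc_self hs)) (norm_nonneg _)
          sys.sum_norm_stateMap_nonneg
      · rw [Set.uIoc_of_le ht.1] at hs
        exact (sys.stateMap (q s)).hasSum (hφ s hs.1.le).hasSum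
    have h1 := (hφ t ht.1).tsum_eq_zero_add
    rw [hsum.tsum_eq] at h1
    simpa [picardTerm, stateMap_apply] using h1

end Existence

variable {sys : LSS n m p M}

theorem isInputOn_zero (T : ℝ) : IsInputOn T (0 : ℝ → Fin m → ℝ) := IntervalIntegrable.zero

/-- A state is unobservable if and only if its zero input response is invisible for every switching
signal. -/
theorem mem_unobservableSet_iff {x : Fin n → ℝ} :
    x ∈ sys.unobservableSet ↔ ∀ q : ℝ → Fin M, (∀ T : ℝ, 0 ≤ T → IsSwitchingSignalOn T q) →
      ∃ φ : ℝ → Fin n → ℝ, (∀ T : ℝ, 0 ≤ T → sys.IsTrajectoryOn T x 0 q φ) ∧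
        ∀ t : ℝ, 0 ≤ t → sys.C (q t) *ᵥ φ t = 0 := by
  refine ⟨fun h q hq => ?_, fun h q hq => ?_⟩
  · obtain ⟨u, hu, φ, φ₀, hφ, hφ₀, hy⟩ := h q hq
    -- The difference of two responses to the same input is a zero input response.
    refine ⟨φ + (-1 : ℝ) • φ₀, fun T hT => ?_, fun t ht => ?_⟩
    · simpa using (hφ T hT).add_smul (hφ₀ T hT) (hq T hT) (hu T hT) (hu T hT) (-1)
    · simp [mulVec_add, mulVec_neg, hy t ht]
  · obtain ⟨φ, hφ, hy⟩ := h q hq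
    obtain ⟨φ₀, hφ₀⟩ := sys.exists_isTrajectoryOn_zero_input 0 hq
    refine ⟨0, fun T _ => isInputOn_zero T, φ, φ₀, hφ, hφ₀, fun t ht => ?_⟩
    have h0 := (hφ₀ t ht).mem_of_invariant (V := ⊥) (hq t ht) (isInputOn_zero t) (by simp)
      (by simp) (by simp) ⟨ht, le_rfl⟩
    rw [hy t ht, (Submodule.mem_bot ℝ).1 h0, mulVec_zero]

theorem add_smul_mem_unobservableSet {x y : Fin n → ℝ} (hx : x ∈ sys.unobservableSet)
    (hy : y ∈ sys.unobservableSet) (c : ℝ) : x + c • y ∈ sys.unobservableSet := by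
  rw [mem_unobservableSet_iff] at hx hy ⊢
  intro q hq
  obtain ⟨φ, hφ, hφC⟩ := hx q hq
  obtain ⟨ψ, hψ, hψC⟩ := hy q hq
  refine ⟨φ + c • ψ, fun T hT => ?_, fun t ht => ?_⟩
  · simpa using (hφ T hT).add_smul (hψ T hT) (hq T hT) (isInputOn_zero T) (isInputOn_zero T) c
  · simp [mulVec_add, mulVec_smul, hφC t ht, hψC t ht]

/-- A subspace that is invariant under all modes and invisible to all outputs consists of
unobservable states. -/
theorem mem_unobservableSet_of_invariant {V : Submodule ℝ (Fin n → ℝ)}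
    (hA : ∀ j, ∀ x ∈ V, sys.A j *ᵥ x ∈ V) (hC : ∀ j, ∀ x ∈ V, sys.C j *ᵥ x = 0) {x : Fin n → ℝ}
    (hx : x ∈ V) : x ∈ sys.unobservableSet := by
  rw [mem_unobservableSet_iff]
  intro q hq
  obtain ⟨φ, hφ⟩ := sys.exists_isTrajectoryOn_zero_input x hq
  exact ⟨φ, hφ, fun t ht => hC _ _ ((hφ t ht).mem_of_invariant (hq t ht) (isInputOn_zero t) hA
    (by simp) hx ⟨ht, le_rfl⟩)⟩

/-- The set of unobservable states as a subspace. -/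
def unobservableSubmodule (sys : LSS n m p M) : Submodule ℝ (Fin n → ℝ) where
  carrier := sys.unobservableSet
  add_mem' := fun hx hy => by simpa using add_smul_mem_unobservableSet hx hy 1
  zero_mem' := mem_unobservableSet_of_invariant (V := ⊥) (by simp) (by simp) (Submodule.zero_mem _)
  smul_mem' := fun c x hx => by
    have h0 : (0 : Fin n → ℝ) ∈ sys.unobservableSet :=
      mem_unobservableSet_of_invariant (V := ⊥) (by simp) (by simp) (Submodule.zero_mem _)
    simpa using add_smul_mem_unobservableSet h0 hx c

/-- Precede an arbitrary signal by mode j for time t: by uniqueness, the invisible response from x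
continues after t as the response from exp(t Aⱼ) x. -/
theorem exp_mem_unobservableSet {x : Fin n → ℝ} (hx : x ∈ sys.unobservableSet) (j : Fin M) {t : ℝ}
    (ht : 0 ≤ t) : NormedSpace.exp (t • sys.stateMap j) x ∈ sys.unobservableSet := by
  rw [mem_unobservableSet_iff] at hx ⊢
  intro q hq
  have hq' : ∀ T, 0 ≤ T → IsSwitchingSignalOn (t + T) (concatAt t (fun _ => j) q) :=
    fun T hT => (isSwitchingSignalOn_const t j).concat (hq T hT)
  obtain ⟨φ, hφ, hφC⟩ := hx (concatAt t (fun _ => j) q) fun T hT =>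
    (hq' T hT).mono (by linarith)
  obtain ⟨ψ, hψ⟩ := sys.exists_isTrajectoryOn_zero_input (NormedSpace.exp (t • sys.stateMap j) x) hq
  have hφψ : ∀ s, 0 ≤ s → φ (s + t) = ψ s := fun s hs => by
    have hconst := sys.isTrajectoryOn_const t j x 0
    simp only [mulVec_zero, map_zero, add_zero] at hconst
    have hcat := hconst.concat (hψ s hs) ht hs (isSwitchingSignalOn_const t j) (hq s hs)
      (isInputOn_zero t) (isInputOn_zero s)
    have hu : concatAt t (fun _ => (0 : Fin m → ℝ)) 0 = 0 := by
      funext r; simp [concatAt]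
    rw [hu] at hcat
    rw [(hφ (t + s) (by linarith)).unique hcat (hq' s hs) (isInputOn_zero _)
      ⟨by linarith, by linarith⟩, concatAt_of_le _ _ (by linarith), add_sub_cancel_right]
  refine ⟨ψ, hψ, fun s hs => ?_⟩
  have h := hφC (s + t) (by linarith)
  rwa [hφψ s hs, concatAt_of_le _ _ (by linarith), add_sub_cancel_right] at h

theorem mulVec_mem_unobservableSubmodule (j : Fin M) {x : Fin n → ℝ}
    (hx : x ∈ sys.unobservableSubmodule) : sys.A j *ᵥ x ∈ sys.unobservableSubmodule := by
  have h := hasDerivAt_exp_smul_apply (sys.stateMap j) x 0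
  rw [zero_smul, NormedSpace.exp_zero] at h
  exact sys.unobservableSubmodule.mem_of_hasDerivAt h fun t ht => exp_mem_unobservableSet hx j ht

theorem output_eq_zero_of_mem_unobservableSet (j : Fin M) {x : Fin n → ℝ}
    (hx : x ∈ sys.unobservableSet) : sys.C j *ᵥ x = 0 := by
  obtain ⟨φ, hφ, hφC⟩ := mem_unobservableSet_iff.1 hx (fun _ => j)
    fun T _ => isSwitchingSignalOn_const T j
  have h0 := (hφ 0 le_rfl).eq_integral 0 ⟨le_rfl, le_rfl⟩
  rw [intervalIntegral.integral_same, add_zero] at h0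
  rw [← h0]
  exact hφC 0 le_rfl

end LSS

/-! ### The two range identities -/

theorem IsHurwitz.transpose {n : ℕ} {A : Matrix (Fin n) (Fin n) ℝ} (hA : IsHurwitz A) :
    IsHurwitz Aᵀ := by
  intro μ hμ
  refine hA μ ?_
  rw [spectrum.mem_iff] at hμ ⊢
  rwa [← Matrix.isUnit_transpose, transpose_sub, Algebra.algebraMap_eq_smul_one, transpose_smul,
    transpose_one, ← Algebra.algebraMap_eq_smul_one]

namespace LSS

variable {n m p M : ℕ} [NeZero M] {sys : LSS n m p M}

theorem A_mulVec_eq (j : Fin M) (x : Fin n → ℝ) :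
    sys.A j *ᵥ x = sys.A 0 *ᵥ x + sys.D j *ᵥ x := by
  rw [← add_mulVec, D, add_sub_cancel]

theorem IsReachGramian.reachableSet_eq {P : Matrix (Fin n) (Fin n) ℝ} (h : sys.IsReachGramian P)
    (hA : IsHurwitz (sys.A 0)) :
    sys.reachableSet = (LinearMap.range P.mulVecLin : Set (Fin n → ℝ)) := by
  obtain ⟨hPA, hPD, hPB⟩ := range_of_generalized_lyapunov h.posSemidef h.eq
  refine Set.Subset.antisymm ?_ ?_
  · rintro _ ⟨T, hT, q, hq, u, hu, φ, hφ, rfl⟩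
    refine hφ.mem_of_invariant hq hu (fun j x hx => ?_) (fun j s => hPB j _)
      (Submodule.zero_mem _) ⟨hT, le_rfl⟩
    rw [A_mulVec_eq]
    exact Submodule.add_mem _ (hPA x hx) (hPD j x hx)
  · obtain ⟨W, hW, hWA, hWB⟩ := sys.exists_invariant_subset_reachableSet
    rintro _ ⟨x, rfl⟩
    refine hW (hA.gramian_mulVec_mem h.posSemidef h.eq h.unique (hWA 0) (fun j x hx => ?_) hWB x)
    rw [D, sub_mulVec]
    exact W.sub_mem (hWA j x hx) (hWA 0 x hx)

theorem IsObservGramian.observableSet_eq {Q : Matrix (Fin n) (Fin n) ℝ}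
    (h : sys.IsObservGramian Q) (hA : IsHurwitz (sys.A 0)) :
    sys.observableSet = (LinearMap.range Q.mulVecLin : Set (Fin n → ℝ)) := by
  -- Duality is used only algebraically: this is the reachability equation of the data Aᵀ, Dⱼᵀ, Cⱼᵀ.
  have hiff : ∀ Q' : Matrix (Fin n) (Fin n) ℝ, sys.ObservLyapunovEq Q' ↔
      (sys.A 0)ᵀ * Q' + Q' * (sys.A 0)ᵀᵀ +
        lyapunovForcing (fun j => (sys.D j)ᵀ) (fun j => (sys.C j)ᵀ) Q' = 0 := fun Q' => by
    simp only [ObservLyapunovEq, lyapunovForcing, transpose_transpose]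
  have heq := (hiff Q).1 h.eq
  have hQt : Qᵀ = Q := h.posSemidef.1
  refine Set.Subset.antisymm (fun y hy => ?_) ?_
  · refine mem_range_mulVecLin_of_forall_ker hQt fun x hx => hy x ?_
    have hker := fun {z} => ker_of_generalized_lyapunov (x := z) h.posSemidef heq
    simp only [transpose_transpose] at hker
    refine mem_unobservableSet_of_invariant (V := LinearMap.ker Q.mulVecLin) (fun j z hz => ?_)
      (fun j z hz => ((hker hz).2 j).2) hx
    rw [A_mulVec_eq]
    exact Submodule.add_mem _ (hker hz).1 ((hker hz).2 j).1
  · let V : Submodule ℝ (Fin n → ℝ) :=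
      { carrier := sys.observableSet
        add_mem' := fun hy hz x hx => by rw [dotProduct_add, hy x hx, hz x hx, add_zero]
        zero_mem' := fun x _ => dotProduct_zero x
        smul_mem' := fun c y hy x hx => by rw [dotProduct_smul, hy x hx, smul_zero] }
    -- The orthogonal complement of an invariant subspace is invariant under the transposes.
    have hV : ∀ j, ∀ y ∈ V, (sys.A j)ᵀ *ᵥ y ∈ V := fun j y hy x hx => by
      rw [dotProduct_mulVec, vecMul_transpose]
      exact hy _ (mulVec_mem_unobservableSubmodule j hx)
    rintro _ ⟨x, rfl⟩
    refine hA.transpose.gramian_mulVec_mem (V := V) h.posSemidef heq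
      (fun Q' hQ' hQ'eq => h.unique Q' hQ' ((hiff Q').2 hQ'eq)) (hV 0) (fun j y hy => ?_)
      (fun j v z hz => ?_) x
    · rw [D, transpose_sub, sub_mulVec]
      exact V.sub_mem (hV j y hy) (hV 0 y hy)
    · rw [dotProduct_mulVec, vecMul_transpose, output_eq_zero_of_mem_unobservableSet j hz,
        zero_dotProduct]

end LSS

theorem theorem3 {n m p M : ℕ} [NeZero M] (sys : LSS n m p M) (hA : IsHurwitz (sys.A 0)) :
    (∀ P : Matrix (Fin n) (Fin n) ℝ, sys.IsReachGramian P →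
      sys.reachableSet = (LinearMap.range P.mulVecLin : Set (Fin n → ℝ))) ∧
    (∀ Q : Matrix (Fin n) (Fin n) ℝ, sys.IsObservGramian Q →
      sys.observableSet = (LinearMap.range Q.mulVecLin : Set (Fin n → ℝ))) :=
  ⟨fun _ hP => hP.reachableSet_eq hA, fun _ hQ => hQ.observableSet_eq hA⟩
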